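/- **Time warps.** Let $\omega^+=\omega\cup\{\omega\}$ with its natural order. A *time warp* is a function $\omega^+\to\omega^+$ preserving arbitrary suprema. Ordered pointwise, the time warps form a lattice with least element $\bot$ and greatest element $\top$; with composition $fg=f\circ g$, the identity $\mathrm{id}$ and the residuals determined by $f\le h/g\iff fg\le h\iff g\le f\backslash h$, they form the *time warp algebra* $\mathbf W=\langle W,\wedge,\vee,\circ,\backslash,/,\mathrm{id},\bot,\top\rangle$. An inequality $s\le t$ of terms stands for the equation $s\wedge t\approx s$. *Basic terms* are generated from countably many variables by $t,u::=x\mid tu\mid t^{o}\mid t^{\ell}\mid t^{r}\mid\mathrm{id}\mid\bot$, where $t^{o}:=\top\backslash t$, $t^{\ell}:=\mathrm{id}/t$, $t^{r}:=t\backslash\mathrm{id}$. **Samples.** *Samples* are generated by $\alpha::=\kappa\mid t[\alpha]\mid \mathsf s(\alpha)\mid\mathsf p(\alpha)\mid\mathsf{last}(t)$, with $\kappa$ a time variable (from a countable set) and $t$ a basic term. Let $\leadsto$ be the relation $t[\alpha]\leadsto\alpha$; $\mathsf s(\alpha)\leadsto\alpha$; $\mathsf p(\alpha)\leadsto\alpha$;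 $tu[\alpha]\leadsto t[u[\alpha]]$; $t^{o}[\alpha]\leadsto t[\alpha]$; $t^{r}[\alpha]\leadsto t[t^{r}[\alpha]]$ and $t^{r}[\alpha]\leadsto t[\mathsf s(t^{r}[\alpha])]$; $t^{\ell}[\alpha]\leadsto t[t^{\ell}[\alpha]]$ and $t^{\ell}[\alpha]\leadsto t[\mathsf p(t^{\ell}[\alpha])]$; $t[\alpha]\leadsto t[\mathsf{last}(t)]$. Fix basic terms $t_1,\dots,t_n$ ($n\ge1$) and a time variable $\kappa$, and let $\Delta$ be the (finite) set of samples reachable from $t_1[\kappa],\dots,t_n[\kappa]$ by the reflexive transitive closure of $\leadsto$. **The formula.** Let $\tau$ have binary relation symbols $\preceq,\mathsf S$ and unary relation symbols $\mathsf O,\mathsf I$; write $a\prec b$ for $a\preceq b\wedge\neg(b\preceq a)$. Let $\psi$ be the quantifier-free $\tau$-formula with variables in $\Delta$ that is the conjunction of the following formulas, for all basic terms $t,u$ and samples $\alpha,\beta$ such that the indicated samples lie in $\Delta$. * Structure: $\alpha\preceq\beta\Rightarrow t[\alpha]\preceq t[\beta]$ and $\mathsf I(\alpha)\Rightarrow\mathsf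 I(t[\alpha])$ (for $t[\alpha],t[\beta]\in\Delta$); $\mathsf S(\mathsf p(\alpha),\alpha)\vee(\mathsf I(\mathsf p(\alpha))\wedge\mathsf I(\alpha))$ ($\mathsf p(\alpha)\in\Delta$); $\mathsf S(\alpha,\mathsf s(\alpha))$ ($\mathsf s(\alpha)\in\Delta$); $\mathsf{last}(t)\preceq\alpha\Leftrightarrow t[\alpha]=t[\mathsf{last}(t)]$ ($t[\alpha]\in\Delta$); $\mathsf O(\mathsf{last}(t))\Rightarrow\mathsf O(t[\mathsf{last}(t)])$ ($t[\mathsf{last}(t)]\in\Delta$). * Logic: $\mathrm{id}[\alpha]=\alpha$ ($\mathrm{id}[\alpha]\in\Delta$); $\mathsf I(\mathsf{last}(\bot))$ (if some $\bot[\alpha]\in\Delta$); $tu[\alpha]=t[u[\alpha]]$ ($tu[\alpha]\in\Delta$); $\mathsf O(\mathsf{last}(tu))\Rightarrow\mathsf O(\mathsf{last}(t))\wedge\mathsf O(\mathsf{last}(u))$ ($tu[\mathsf{last}(tu)]\in\Delta$). * Bounds: $\mathsf I(t^{o}[\alpha])\vee\mathsf O(t^{o}[\alpha])$ and $\neg\mathsf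 O(\alpha)\Rightarrow(\mathsf O(t^{o}[\alpha])\Leftrightarrow\mathsf O(t[\alpha]))$ ($t^{o}[\alpha]\in\Delta$); $\neg\mathsf O(\mathsf{last}(t^{o}))$ ($\mathsf{last}(t^{o})\in\Delta$); $\neg\mathsf O(t^{o}[\mathsf{last}(t^{o})])\wedge\neg\mathsf O(\alpha)\Rightarrow\neg\mathsf O(t[\alpha])$ ($t[\alpha],t^{o}[\mathsf{last}(t^{o})]\in\Delta$). * Right: $t[t^{r}[\alpha]]\preceq\alpha$ ($t[t^{r}[\alpha]]\in\Delta$); $\neg\mathsf I(\alpha)\wedge\neg\mathsf O(\alpha)\wedge\neg\mathsf O(t^{r}[\alpha])\Rightarrow\alpha\prec t[\mathsf s(t^{r}[\alpha])]$ ($t[\mathsf s(t^{r}[\alpha])]\in\Delta$); $\mathsf O(\mathsf{last}(t^{r}))\Rightarrow\mathsf O(\mathsf{last}(t))$ ($t^{r}[\mathsf{last}(t^{r})]\in\Delta$); $\neg\mathsf O(t^{r}[\mathsf{last}(t^{r})])\Rightarrow\mathsf O(t[\mathsf s(t^{r}[\mathsf{last}(t^{r})])])$ ($t[\mathsf s(t^{r}[\mathsf{last}(t^{r})])]\in\Delta$).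 * Left: $\neg\mathsf O(t^{\ell}[\alpha])\Rightarrow\alpha\preceq t[t^{\ell}[\alpha]]$ and $\neg\mathsf O(\alpha)\wedge\mathsf O(t^{\ell}[\alpha])\Rightarrow t[t^{\ell}[\alpha]]\prec\alpha$ ($t[t^{\ell}[\alpha]]\in\Delta$); $\neg\mathsf I(\alpha)\wedge\neg\mathsf O(\alpha)\wedge\neg\mathsf O(t^{\ell}[\alpha])\Rightarrow t[\mathsf p(t^{\ell}[\alpha])]\prec\alpha$ ($t[\mathsf p(t^{\ell}[\alpha])]\in\Delta$); $\mathsf O(\mathsf{last}(t^{\ell}))\Rightarrow\mathsf O(\mathsf{last}(t))$ and $\neg\mathsf O(t^{\ell}[\mathsf{last}(t^{\ell})])\Rightarrow\mathsf O(t[t^{\ell}[\mathsf{last}(t^{\ell})]])$ ($t^{\ell}[\mathsf{last}(t^{\ell})]\in\Delta$). * Failure: $t_i[\kappa]\prec\kappa$ for $1\le i\le n$. Let $\sigma$ have binary relation symbols $\le,S$ and a constant $0$, and regard $\mathbb N$ as the $\sigma$-structure with its usual order, $S=\{(m,m+1)\mid m\in\mathbb N\}$ and $0$. Let $\varphi$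 be the $\sigma$-formula obtained from $\psi$ by replacing each atom $\mathsf O(x)$ by $x=0$; $\mathsf I(x)$ by $S(0,x)$; $\mathsf S(x,y)$ by $(x=0\wedge y=0)\vee(\neg(x=0)\wedge S(x,y))$; $x\preceq y$ by $y=0\vee(\neg(x=0)\wedge x\le y)$. **Theorem.** For all basic terms $t_1,\dots,t_n$ with $n\ge 1$ and every time variable $\kappa$, the $\sigma$-formula $\varphi$ is quantifier-free, and the equation $\mathrm{id}\le t_1\vee\dots\vee t_n$ is valid in $\mathbf W$ if and only if $\varphi$ is unsatisfiable in $\mathbb N$. Moreover, any $w\colon\Delta\to\mathbb N$ with $\mathbb N,w\models\varphi$ effectively yields a valuation $\theta$ of the variables in time warps under which $\mathrm{id}\le t_1\vee\dots\vee t_n$ fails: there is a single computable function that, for all $t_1,\dots,t_n$ and $\kappa$, given (Gödel numbers of) any finite listing of the graph of such a $w$ and a variable $x$, returns a program that computes the time warp $\theta(x)$ on all of $\omega^+$, where elements of $\omega^+$ are represented by natural numbers via the bijection $\iota\colon\mathbb N\to\omega^+$, $\iota(0)=\omega$, $\iota(m+1)=m$. -/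

import Mathlib

/-! ## The time warp algebra -/

/-- Time warps: functions on `ω ∪ {ω}` that preserve arbitrary suprema. Composition, identity,
least element and pointwise order are those of `sSupHom`. -/
abbrev TimeWarp : Type := sSupHom ℕ∞ ℕ∞

namespace TimeWarp

/-- The pointwise supremum of a set of time warps, the supremum in the lattice of time warps. -/
noncomputable def sup (A : Set TimeWarp) : TimeWarp where
  toFun p := ⨆ f ∈ A, f p
  map_sSup' S := by
    rw [sSup_image]
    simp only [map_sSup, sSup_image]
    apply le_antisymm
    · exact iSup₂_le fun f hf => iSup₂_le fun p hp =>
        le_iSup₂_of_le p hp (le_iSup₂_of_le (f := fun (f : TimeWarp) (_ : f ∈ A) => f p) f hf le_rfl)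
    · exact iSup₂_le fun p hp => iSup₂_le fun f hf =>
        le_iSup₂_of_le f hf (le_iSup₂_of_le (f := fun (p : ℕ∞) (_ : p ∈ S) => f p) p hp le_rfl)

noncomputable def join (f g : TimeWarp) : TimeWarp := sup {f, g}

theorem monotone (f : TimeWarp) : Monotone f := OrderHomClass.mono f

noncomputable def meet (f g : TimeWarp) : TimeWarp where
  toFun p := f p ⊓ g p
  map_sSup' S := by
    rw [sSup_image]
    simp only [map_sSup, sSup_image]
    apply le_antisymm
    · rw [iSup₂_inf_eq]
      refine iSup₂_le fun p hp => ?_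
      rw [inf_iSup₂_eq]
      refine iSup₂_le fun q hq => ?_
      rcases le_total p q with h | h
      · exact le_iSup₂_of_le q hq (inf_le_inf (monotone f h) le_rfl)
      · exact le_iSup₂_of_le p hp (inf_le_inf le_rfl (monotone g h))
    · exact iSup₂_le fun p hp => inf_le_inf
        (le_iSup₂_of_le (f := fun (p : ℕ∞) (_ : p ∈ S) => f p) p hp le_rfl)
        (le_iSup₂_of_le (f := fun (p : ℕ∞) (_ : p ∈ S) => g p) p hp le_rfl)

/-- The greatest time warp (it maps every `p ≠ 0` to `ω`). -/
noncomputable def top : TimeWarp := sup Set.univ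

/-- The residual `f \ h`, the greatest `g` with `f ∘ g ≤ h`. -/
noncomputable def ldiv (f h : TimeWarp) : TimeWarp := sup {g | f.comp g ≤ h}

/-- The residual `h / g`, the greatest `f` with `f ∘ g ≤ h`. -/
noncomputable def rdiv (h g : TimeWarp) : TimeWarp := sup {f | f.comp g ≤ h}

theorem le_sup {A : Set TimeWarp} {f : TimeWarp} (hf : f ∈ A) : f ≤ sup A := fun p =>
  le_iSup₂_of_le (f := fun (f : TimeWarp) (_ : f ∈ A) => f p) f hf le_rfl

theorem le_ldiv_iff (f g h : TimeWarp) : g ≤ ldiv f h ↔ f.comp g ≤ h := by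
  refine ⟨fun hg p => ?_, fun hg => le_sup hg⟩
  have h1 : f (g p) ≤ f (⨆ k ∈ {k : TimeWarp | f.comp k ≤ h}, k p) := monotone f (hg p)
  refine h1.trans ?_
  rw [map_iSup₂]
  exact iSup₂_le fun k hk => hk p

theorem le_rdiv_iff (f g h : TimeWarp) : f ≤ rdiv h g ↔ f.comp g ≤ h := by
  refine ⟨fun hf p => ?_, fun hf => le_sup hf⟩
  exact (hf (g p)).trans (iSup₂_le fun k hk => hk p)

end TimeWarp

/-! ## Terms, equations, basic terms -/

inductive WarpTerm : Type
  | var (x : ℕ)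
  | meet (s t : WarpTerm)
  | join (s t : WarpTerm)
  | comp (s t : WarpTerm)
  | ldiv (s t : WarpTerm)
  | rdiv (s t : WarpTerm)
  | ident
  | bot
  | top

noncomputable def WarpTerm.eval (θ : ℕ → TimeWarp) : WarpTerm → TimeWarp
  | var x => θ x
  | meet s t => (s.eval θ).meet (t.eval θ)
  | join s t => (s.eval θ).join (t.eval θ)
  | comp s t => sSupHom.comp (s.eval θ) (t.eval θ)
  | ldiv s t => (s.eval θ).ldiv (t.eval θ)
  | rdiv s t => (s.eval θ).rdiv (t.eval θ)
  | ident => sSupHom.id ℕ∞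
  | bot => ⊥
  | top => TimeWarp.top

structure WarpEquation : Type where
  lhs : WarpTerm
  rhs : WarpTerm

namespace WarpEquation

/-- `s ≤ t` stands for the equation `s ∧ t ≈ s`. -/
def le (s t : WarpTerm) : WarpEquation := ⟨s.meet t, s⟩

/-- The equation holds in the time warp algebra under the valuation `θ`. -/
def Holds (θ : ℕ → TimeWarp) (e : WarpEquation) : Prop := e.lhs.eval θ = e.rhs.eval θ

def Valid (e : WarpEquation) : Prop := ∀ θ : ℕ → TimeWarp, e.Holds θ

end WarpEquation

inductive BasicTerm : Type
  | var (x : ℕ)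
  | comp (t u : BasicTerm)
  | o (t : BasicTerm)
  | l (t : BasicTerm)
  | r (t : BasicTerm)
  | ident
  | bot

/-- A basic term as a time warp term: `tᵒ = ⊤ \ t`, `tˡ = id / t`, `tʳ = t \ id`. -/
def BasicTerm.toTerm : BasicTerm → WarpTerm
  | var x => .var x
  | comp t u => .comp t.toTerm u.toTerm
  | o t => .ldiv .top t.toTerm
  | l t => .rdiv .ident t.toTerm
  | r t => .ldiv t.toTerm .ident
  | ident => .ident
  | bot => .bot

/-- The term `t₁ ∨ ⋯ ∨ tₙ`. -/
def joinTerm : List BasicTerm → WarpTerm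
  | [] => .bot
  | [t] => t.toTerm
  | t :: u :: ts => .join t.toTerm (joinTerm (u :: ts))

/-- The equation `id ≤ t₁ ∨ ⋯ ∨ tₙ`. -/
def idLeJoin (ts : List BasicTerm) : WarpEquation := WarpEquation.le .ident (joinTerm ts)

/-! ## Samples and saturation -/

/-- Samples: time variables, `t[α]`, `s(α)`, `p(α)` and `last(t)`. -/
inductive Sample : Type
  | tvar (κ : ℕ)
  | app (t : BasicTerm) (α : Sample)
  | suc (α : Sample)
  | pre (α : Sample)
  | last (t : BasicTerm)

namespace Sample

inductive Step : Sample → Sample → Prop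
  | arg (t : BasicTerm) (α : Sample) : Step (app t α) α
  | suc (α : Sample) : Step (suc α) α
  | pre (α : Sample) : Step (pre α) α
  | comp (t u : BasicTerm) (α : Sample) : Step (app (.comp t u) α) (app t (app u α))
  | o (t : BasicTerm) (α : Sample) : Step (app (.o t) α) (app t α)
  | r (t : BasicTerm) (α : Sample) : Step (app (.r t) α) (app t (app (.r t) α))
  | rSuc (t : BasicTerm) (α : Sample) : Step (app (.r t) α) (app t (.suc (app (.r t) α)))
  | l (t : BasicTerm) (α : Sample) : Step (app (.l t) α) (app t (app (.l t) α))
  | lPre (t : BasicTerm) (α : Sample) : Step (app (.l t) α) (app t (.pre (app (.l t) α)))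
  | last (t : BasicTerm) (α : Sample) : Step (app t α) (app t (.last t))

def Saturated (Δ : Set Sample) : Prop := ∀ ⦃α β : Sample⦄, α ∈ Δ → Step α β → β ∈ Δ

def saturation (Δ : Set Sample) : Set Sample :=
  {β | ∃ α ∈ Δ, Relation.ReflTransGen Step α β}

theorem saturated_saturation (Δ : Set Sample) : Saturated (saturation Δ) := by
  rintro α β ⟨γ, hγ, h⟩ hs
  exact ⟨γ, hγ, h.tail hs⟩

theorem subset_saturation (Δ : Set Sample) : Δ ⊆ saturation Δ := fun α h => ⟨α, h, .refl⟩

theorem exists_finite_closure (t : BasicTerm) : ∀ α : Sample, ∃ E : Set Sample, E.Finite ∧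
    app t α ∈ E ∧ ∀ β ∈ E, ∀ γ, Step β γ → γ ∈ E ∨ γ = α := by
  induction t with
  | var x =>
    intro α
    refine ⟨{app (.var x) α, app (.var x) (last (.var x)), last (.var x)}, by simp, by simp, ?_⟩
    rintro β (rfl | rfl | rfl) γ h <;> cases h <;> simp
  | ident =>
    intro α
    refine ⟨{app .ident α, app .ident (last .ident), last .ident}, by simp, by simp, ?_⟩
    rintro β (rfl | rfl | rfl) γ h <;> cases h <;> simp
  | bot =>
    intro α
    refine ⟨{app .bot α, app .bot (last .bot), last .bot}, by simp, by simp, ?_⟩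
    rintro β (rfl | rfl | rfl) γ h <;> cases h <;> simp
  | comp t u iht ihu =>
    intro α
    obtain ⟨A, fA, mA, cA⟩ := iht (app u α)
    obtain ⟨B, fB, mB, cB⟩ := ihu α
    obtain ⟨C, fC, mC, cC⟩ := iht (app u (last (.comp t u)))
    obtain ⟨D, fD, mD, cD⟩ := ihu (last (.comp t u))
    refine ⟨{app (.comp t u) α, app (.comp t u) (last (.comp t u)), last (.comp t u)} ∪
      (A ∪ B ∪ (C ∪ D)), ?_, by simp, ?_⟩
    · exact (Set.toFinite _).union ((fA.union fB).union (fC.union fD))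
    · rintro β ((rfl | rfl | rfl) | ((h | h) | (h | h))) γ hs
      · cases hs <;> simp [mA]
      · cases hs <;> simp [mC]
      · cases hs
      · rcases cA β h γ hs with h' | rfl <;> simp [*]
      · rcases cB β h γ hs with h' | rfl <;> simp [*]
      · rcases cC β h γ hs with h' | rfl <;> simp [*]
      · rcases cD β h γ hs with h' | rfl <;> simp [*]
  | o t ih =>
    intro α
    obtain ⟨A, fA, mA, cA⟩ := ih α
    obtain ⟨B, fB, mB, cB⟩ := ih (last (.o t))
    refine ⟨{app (.o t) α, app (.o t) (last (.o t)), last (.o t)} ∪ (A ∪ B), ?_, by simp, ?_⟩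
    · exact (Set.toFinite _).union (fA.union fB)
    · rintro β ((rfl | rfl | rfl) | (h | h)) γ hs
      · cases hs <;> simp [mA]
      · cases hs <;> simp [mB]
      · cases hs
      · rcases cA β h γ hs with h' | rfl <;> simp [*]
      · rcases cB β h γ hs with h' | rfl <;> simp [*]
  | r t ih =>
    intro α
    obtain ⟨A, fA, mA, cA⟩ := ih (app (.r t) α)
    obtain ⟨B, fB, mB, cB⟩ := ih (suc (app (.r t) α))
    obtain ⟨C, fC, mC, cC⟩ := ih (app (.r t) (last (.r t)))
    obtain ⟨D, fD, mD, cD⟩ := ih (suc (app (.r t) (last (.r t))))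
    refine ⟨{app (.r t) α, app (.r t) (last (.r t)), last (.r t), suc (app (.r t) α),
      suc (app (.r t) (last (.r t)))} ∪ (A ∪ B ∪ (C ∪ D)), ?_, by simp, ?_⟩
    · exact (Set.toFinite _).union ((fA.union fB).union (fC.union fD))
    · rintro β ((rfl | rfl | rfl | rfl | rfl) | ((h | h) | (h | h))) γ hs
      · cases hs <;> simp [mA, mB]
      · cases hs <;> simp [mC, mD]
      · cases hs
      · cases hs; simp
      · cases hs; simp
      · rcases cA β h γ hs with h' | rfl <;> simp [*]
      · rcases cB β h γ hs with h' | rfl <;> simp [*]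
      · rcases cC β h γ hs with h' | rfl <;> simp [*]
      · rcases cD β h γ hs with h' | rfl <;> simp [*]
  | l t ih =>
    intro α
    obtain ⟨A, fA, mA, cA⟩ := ih (app (.l t) α)
    obtain ⟨B, fB, mB, cB⟩ := ih (pre (app (.l t) α))
    obtain ⟨C, fC, mC, cC⟩ := ih (app (.l t) (last (.l t)))
    obtain ⟨D, fD, mD, cD⟩ := ih (pre (app (.l t) (last (.l t))))
    refine ⟨{app (.l t) α, app (.l t) (last (.l t)), last (.l t), pre (app (.l t) α),
      pre (app (.l t) (last (.l t)))} ∪ (A ∪ B ∪ (C ∪ D)), ?_, by simp, ?_⟩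
    · exact (Set.toFinite _).union ((fA.union fB).union (fC.union fD))
    · rintro β ((rfl | rfl | rfl | rfl | rfl) | ((h | h) | (h | h))) γ hs
      · cases hs <;> simp [mA, mB]
      · cases hs <;> simp [mC, mD]
      · cases hs
      · cases hs; simp
      · cases hs; simp
      · rcases cA β h γ hs with h' | rfl <;> simp [*]
      · rcases cB β h γ hs with h' | rfl <;> simp [*]
      · rcases cC β h γ hs with h' | rfl <;> simp [*]
      · rcases cD β h γ hs with h' | rfl <;> simp [*]

/-- The saturation `Δ` of `{t₁[κ], …, tₙ[κ]}`. -/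
def diagramDomain (κ : ℕ) (ts : List BasicTerm) : Set Sample :=
  saturation {α | ∃ t ∈ ts, α = app t (tvar κ)}

theorem diagramDomain_finite (κ : ℕ) (ts : List BasicTerm) : (diagramDomain κ ts).Finite := by
  choose E hfin hmem hcl using fun t => exists_finite_closure t (tvar κ)
  have hF : ((⋃ t ∈ {t | t ∈ ts}, E t) ∪ {tvar κ}).Finite :=
    ((List.finite_toSet ts).biUnion fun t _ => hfin t).union (Set.finite_singleton _)
  refine hF.subset ?_
  rintro β ⟨α, ⟨t, ht, rfl⟩, h⟩
  induction h with
  | refl => exact Or.inl (Set.mem_biUnion (x := t) ht (hmem t))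
  | tail _ hs ih =>
    rcases ih with ih | ih
    · simp only [Set.mem_iUnion] at ih
      obtain ⟨u, hu, hb⟩ := ih
      rcases hcl u _ hb _ hs with h' | h'
      · exact Or.inl (Set.mem_biUnion (x := u) hu h')
      · exact Or.inr h'
    · cases ih; cases hs

instance (κ : ℕ) (ts : List BasicTerm) : Finite (diagramDomain κ ts) :=
  (diagramDomain_finite κ ts).to_subtype

end Sample

/-! ## The two signatures -/

/-- The relation symbols of `τ`: `I` ("is zero"), `O` ("is `ω`"), order and successor. -/
inductive TauRel : ℕ → Type
  | I : TauRel 1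
  | O : TauRel 1
  | le : TauRel 2
  | S : TauRel 2

def tau : FirstOrder.Language := ⟨fun _ => Empty, TauRel⟩

inductive SigmaFun : ℕ → Type
  | zero : SigmaFun 0

inductive SigmaRel : ℕ → Type
  | le : SigmaRel 2
  | S : SigmaRel 2

def sigma : FirstOrder.Language := ⟨SigmaFun, SigmaRel⟩

/-- The standard `σ`-structure `(ℕ, ≤, S, 0)`; `S` is the successor relation. -/
instance sigmaNat : sigma.Structure ℕ where
  funMap f _ := match f with
    | SigmaFun.zero => 0
  RelMap R v := match R, v with
    | SigmaRel.le, v => v 0 ≤ v 1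
    | SigmaRel.S, v => v 1 = v 0 + 1

namespace tau

variable {V : Type}

/-- A variable as a term. -/
def v (x : V) : tau.Term (V ⊕ Fin 0) := .var (.inl x)

def I (x : V) : tau.Formula V := FirstOrder.Language.BoundedFormula.rel TauRel.I ![v x]

def O (x : V) : tau.Formula V := FirstOrder.Language.BoundedFormula.rel TauRel.O ![v x]

def S (x y : V) : tau.Formula V := FirstOrder.Language.BoundedFormula.rel TauRel.S ![v x, v y]

def le (x y : V) : tau.Formula V := FirstOrder.Language.BoundedFormula.rel TauRel.le ![v x, v y]

def eq (x y : V) : tau.Formula V := .equal (v x) (v y)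

def lt (x y : V) : tau.Formula V := le x y ⊓ (le y x).not

end tau

/-! ## Replacing `τ`-atoms by `σ`-formulas -/

def tauTermToSigma {V : Type} : tau.Term V → sigma.Term V
  | .var x => .var x
  | .func f _ => nomatch f

def sigmaZero {V : Type} : sigma.Term V := .func SigmaFun.zero ![]

/-- The replacement of the atomic `τ`-formulas `I(x)`, `O(x)`, `x ≼ y`, `S(x, y)`. -/
def tauAtomToSigma {V : Type} {n l : ℕ} (R : TauRel l) (ts : Fin l → sigma.Term (V ⊕ Fin n)) :
    sigma.BoundedFormula V n :=
  match R, ts with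
  | .O, ts => .equal (ts 0) sigmaZero
  | .I, ts => .rel SigmaRel.S ![sigmaZero, ts 0]
  | .S, ts =>
      (.equal (ts 0) sigmaZero ⊓ .equal (ts 1) sigmaZero) ⊔
        ((FirstOrder.Language.BoundedFormula.equal (ts 0) sigmaZero).not ⊓
          .rel SigmaRel.S ![ts 0, ts 1])
  | .le, ts =>
      .equal (ts 1) sigmaZero ⊔
        ((FirstOrder.Language.BoundedFormula.equal (ts 0) sigmaZero).not ⊓
          .rel SigmaRel.le ![ts 0, ts 1])

/-- The `σ`-formula `χ'` obtained from a `τ`-formula `χ` (only used for quantifier-free `χ`). -/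
def tauToSigma {V : Type} : {n : ℕ} → tau.BoundedFormula V n → sigma.BoundedFormula V n
  | _, .falsum => .falsum
  | _, .equal s t => .equal (tauTermToSigma s) (tauTermToSigma t)
  | _, .rel R ts => tauAtomToSigma R fun i => tauTermToSigma (ts i)
  | _, .imp χ₁ χ₂ => .imp (tauToSigma χ₁) (tauToSigma χ₂)
  | _, .all χ => .all (tauToSigma χ)

/-! ## The formula expressing the existence of a refuting diagram -/

namespace Sample

namespace Saturated

variable {Δ : Set Sample} {t u : BasicTerm} {α : Sample}

theorem arg (hΔ : Saturated Δ) (h : app t α ∈ Δ) : α ∈ Δ := hΔ h (.arg t α)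
theorem ofSuc (hΔ : Saturated Δ) (h : suc α ∈ Δ) : α ∈ Δ := hΔ h (.suc α)
theorem ofPre (hΔ : Saturated Δ) (h : pre α ∈ Δ) : α ∈ Δ := hΔ h (.pre α)
theorem comp (hΔ : Saturated Δ) (h : app (.comp t u) α ∈ Δ) : app t (app u α) ∈ Δ := hΔ h (.comp t u α)
theorem o (hΔ : Saturated Δ) (h : app (.o t) α ∈ Δ) : app t α ∈ Δ := hΔ h (.o t α)
theorem r (hΔ : Saturated Δ) (h : app (.r t) α ∈ Δ) : app t (app (.r t) α) ∈ Δ := hΔ h (.r t α)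
theorem l (hΔ : Saturated Δ) (h : app (.l t) α ∈ Δ) : app t (app (.l t) α) ∈ Δ := hΔ h (.l t α)
theorem appLast (hΔ : Saturated Δ) (h : app t α ∈ Δ) : app t (last t) ∈ Δ := hΔ h (.last t α)
theorem last (hΔ : Saturated Δ) (h : app t α ∈ Δ) : Sample.last t ∈ Δ := hΔ.arg (hΔ.appLast h)

end Saturated

open tau

variable {Δ : Set Sample}

def structSet (hΔ : Saturated Δ) : Set (tau.Formula Δ) :=
  {χ | ∃ (t : BasicTerm) (α β : Sample) (h : app t α ∈ Δ) (k : app t β ∈ Δ),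
    χ = (le ⟨α, hΔ.arg h⟩ ⟨β, hΔ.arg k⟩).imp (le ⟨app t α, h⟩ ⟨app t β, k⟩)} ∪
  {χ | ∃ (t : BasicTerm) (α : Sample) (h : app t α ∈ Δ),
    χ = (I ⟨α, hΔ.arg h⟩).imp (I ⟨app t α, h⟩)} ∪
  {χ | ∃ (α : Sample) (h : pre α ∈ Δ),
    χ = S ⟨pre α, h⟩ ⟨α, hΔ.ofPre h⟩ ⊔ (I ⟨pre α, h⟩ ⊓ I ⟨α, hΔ.ofPre h⟩)} ∪
  {χ | ∃ (α : Sample) (h : suc α ∈ Δ), χ = S ⟨α, hΔ.ofSuc h⟩ ⟨suc α, h⟩} ∪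
  {χ | ∃ (t : BasicTerm) (α : Sample) (h : app t α ∈ Δ),
    χ = (le ⟨last t, hΔ.last h⟩ ⟨α, hΔ.arg h⟩).iff
      (eq ⟨app t α, h⟩ ⟨app t (last t), hΔ.appLast h⟩)} ∪
  {χ | ∃ (t : BasicTerm) (h : app t (last t) ∈ Δ),
    χ = (O ⟨last t, hΔ.arg h⟩).imp (O ⟨app t (last t), h⟩)}

def logSet (hΔ : Saturated Δ) : Set (tau.Formula Δ) :=
  {χ | ∃ (α : Sample) (h : app .ident α ∈ Δ), χ = eq ⟨app .ident α, h⟩ ⟨α, hΔ.arg h⟩} ∪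
  {χ | ∃ (α : Sample) (h : app .bot α ∈ Δ), χ = I ⟨last .bot, hΔ.last h⟩} ∪
  {χ | ∃ (t u : BasicTerm) (α : Sample) (h : app (.comp t u) α ∈ Δ),
    χ = eq ⟨app (.comp t u) α, h⟩ ⟨app t (app u α), hΔ.comp h⟩} ∪
  {χ | ∃ (t u : BasicTerm) (h : app (.comp t u) (last (.comp t u)) ∈ Δ),
    χ = (O ⟨last (.comp t u), hΔ.arg h⟩).imp
      (O ⟨last t, hΔ.last (hΔ.comp h)⟩ ⊓ O ⟨last u, hΔ.last (hΔ.arg (hΔ.comp h))⟩)}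

def boundsSet (hΔ : Saturated Δ) : Set (tau.Formula Δ) :=
  {χ | ∃ (t : BasicTerm) (α : Sample) (h : app (.o t) α ∈ Δ),
    χ = I ⟨app (.o t) α, h⟩ ⊔ O ⟨app (.o t) α, h⟩} ∪
  {χ | ∃ (t : BasicTerm) (α : Sample) (h : app (.o t) α ∈ Δ),
    χ = (O ⟨α, hΔ.arg h⟩).not.imp ((O ⟨app (.o t) α, h⟩).iff (O ⟨app t α, hΔ.o h⟩))} ∪
  {χ | ∃ (t : BasicTerm) (h : last (.o t) ∈ Δ), χ = (O ⟨last (.o t), h⟩).not} ∪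
  {χ | ∃ (t : BasicTerm) (α : Sample) (h : app t α ∈ Δ) (k : app (.o t) (last (.o t)) ∈ Δ),
    χ = ((O ⟨app (.o t) (last (.o t)), k⟩).not ⊓ (O ⟨α, hΔ.arg h⟩).not).imp
      (O ⟨app t α, h⟩).not}

def rightSet (hΔ : Saturated Δ) : Set (tau.Formula Δ) :=
  {χ | ∃ (t : BasicTerm) (α : Sample) (h : app t (app (.r t) α) ∈ Δ),
    χ = le ⟨app t (app (.r t) α), h⟩ ⟨α, hΔ.arg (hΔ.arg h)⟩} ∪
  {χ | ∃ (t : BasicTerm) (α : Sample) (h : app t (suc (app (.r t) α)) ∈ Δ),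
    χ = ((I ⟨α, hΔ.arg (hΔ.ofSuc (hΔ.arg h))⟩).not ⊓
        (O ⟨α, hΔ.arg (hΔ.ofSuc (hΔ.arg h))⟩).not ⊓
        (O ⟨app (.r t) α, hΔ.ofSuc (hΔ.arg h)⟩).not).imp
      (lt ⟨α, hΔ.arg (hΔ.ofSuc (hΔ.arg h))⟩ ⟨app t (suc (app (.r t) α)), h⟩)} ∪
  {χ | ∃ (t : BasicTerm) (h : app (.r t) (last (.r t)) ∈ Δ),
    χ = (O ⟨last (.r t), hΔ.arg h⟩).imp (O ⟨last t, hΔ.last (hΔ.r h)⟩)} ∪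
  {χ | ∃ (t : BasicTerm) (h : app t (suc (app (.r t) (last (.r t)))) ∈ Δ),
    χ = (O ⟨app (.r t) (last (.r t)), hΔ.ofSuc (hΔ.arg h)⟩).not.imp
      (O ⟨app t (suc (app (.r t) (last (.r t)))), h⟩)}

def leftSet (hΔ : Saturated Δ) : Set (tau.Formula Δ) :=
  {χ | ∃ (t : BasicTerm) (α : Sample) (h : app t (app (.l t) α) ∈ Δ),
    χ = (O ⟨app (.l t) α, hΔ.arg h⟩).not.imp
      (le ⟨α, hΔ.arg (hΔ.arg h)⟩ ⟨app t (app (.l t) α), h⟩)} ∪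
  {χ | ∃ (t : BasicTerm) (α : Sample) (h : app t (pre (app (.l t) α)) ∈ Δ),
    χ = ((I ⟨α, hΔ.arg (hΔ.ofPre (hΔ.arg h))⟩).not ⊓
        (O ⟨α, hΔ.arg (hΔ.ofPre (hΔ.arg h))⟩).not ⊓
        (O ⟨app (.l t) α, hΔ.ofPre (hΔ.arg h)⟩).not).imp
      (lt ⟨app t (pre (app (.l t) α)), h⟩ ⟨α, hΔ.arg (hΔ.ofPre (hΔ.arg h))⟩)} ∪
  {χ | ∃ (t : BasicTerm) (α : Sample) (h : app t (app (.l t) α) ∈ Δ),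
    χ = ((O ⟨α, hΔ.arg (hΔ.arg h)⟩).not ⊓ O ⟨app (.l t) α, hΔ.arg h⟩).imp
      (lt ⟨app t (app (.l t) α), h⟩ ⟨α, hΔ.arg (hΔ.arg h)⟩)} ∪
  {χ | ∃ (t : BasicTerm) (h : app (.l t) (last (.l t)) ∈ Δ),
    χ = (O ⟨last (.l t), hΔ.arg h⟩).imp (O ⟨last t, hΔ.last (hΔ.l h)⟩)} ∪
  {χ | ∃ (t : BasicTerm) (h : app (.l t) (last (.l t)) ∈ Δ),
    χ = (O ⟨app (.l t) (last (.l t)), h⟩).not.imp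
      (O ⟨app t (app (.l t) (last (.l t))), hΔ.l h⟩)}

/-- The failure of `id ≤ t₁ ∨ ⋯ ∨ tₙ` at the time variable `κ`. -/
def failSet (hΔ : Saturated Δ) (κ : ℕ) (ts : List BasicTerm) : Set (tau.Formula Δ) :=
  {χ | ∃ t ∈ ts, ∃ h : app t (tvar κ) ∈ Δ, χ = lt ⟨app t (tvar κ), h⟩ ⟨tvar κ, hΔ.arg h⟩}

def psiSet (hΔ : Saturated Δ) (κ : ℕ) (ts : List BasicTerm) : Set (tau.Formula Δ) :=
  structSet hΔ ∪ logSet hΔ ∪ boundsSet hΔ ∪ rightSet hΔ ∪ leftSet hΔ ∪ failSet hΔ κ ts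

theorem finite_family {ι X : Type} [Finite Δ] (e : ι → Sample) (he : Function.Injective e)
    (f : ∀ i, e i ∈ Δ → X) : {χ | ∃ (i : ι) (h : e i ∈ Δ), χ = f i h}.Finite := by
  have : Finite {i // e i ∈ Δ} := Finite.of_injective
    (fun i : {i // e i ∈ Δ} => (⟨e i, i.2⟩ : Δ)) fun i j h => Subtype.ext (he (by simpa using h))
  refine (Set.finite_range fun i : {i // e i ∈ Δ} => f i i.2).subset ?_
  rintro χ ⟨i, h, rfl⟩
  exact ⟨⟨i, h⟩, rfl⟩

theorem finite_family₂ {ι ι' X : Type} [Finite Δ] (e : ι → ι' → Sample)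
    (he : Function.Injective2 e) (f : ∀ i j, e i j ∈ Δ → X) :
    {χ | ∃ (i : ι) (j : ι') (h : e i j ∈ Δ), χ = f i j h}.Finite := by
  refine (finite_family (fun p : ι × ι' => e p.1 p.2)
    (fun p q h => Prod.ext (he h).1 (he h).2) fun p h => f p.1 p.2 h).subset ?_
  rintro χ ⟨i, j, h, rfl⟩
  exact ⟨(i, j), h, rfl⟩

theorem psiSet_finite [Finite Δ] (hΔ : Saturated Δ) (κ : ℕ) (ts : List BasicTerm) :
    (psiSet hΔ κ ts).Finite := by
  have hs : (structSet hΔ).Finite := by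
    refine ((((Set.Finite.union ?_ ?_).union ?_).union ?_).union ?_).union ?_
    · have hI : Finite {p : (BasicTerm × Sample) × (BasicTerm × Sample) //
          app p.1.1 p.1.2 ∈ Δ ∧ app p.2.1 p.2.2 ∈ Δ} := Finite.of_injective
        (fun p => ((⟨_, p.2.1⟩, ⟨_, p.2.2⟩) : Δ × Δ)) (by
          rintro ⟨⟨⟨a, b⟩, c, d⟩, _⟩ ⟨⟨⟨a', b'⟩, c', d'⟩, _⟩ h
          simp only [Prod.mk.injEq, Subtype.mk.injEq, app.injEq] at h
          obtain ⟨⟨rfl, rfl⟩, rfl, rfl⟩ := h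
          rfl)
      refine (Set.finite_range fun p : {p : (BasicTerm × Sample) × (BasicTerm × Sample) //
          app p.1.1 p.1.2 ∈ Δ ∧ app p.2.1 p.2.2 ∈ Δ} =>
        (le ⟨p.1.1.2, hΔ.arg p.2.1⟩ ⟨p.1.2.2, hΔ.arg p.2.2⟩).imp
          (le ⟨app p.1.1.1 p.1.1.2, p.2.1⟩ ⟨app p.1.2.1 p.1.2.2, p.2.2⟩)).subset ?_
      rintro χ ⟨t, α, β, h, k, rfl⟩
      exact ⟨⟨((t, α), (t, β)), h, k⟩, rfl⟩
    · exact finite_family₂ app (fun a b c d h => by simpa using h) _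
    · exact finite_family pre (fun a b h => by simpa using h) _
    · exact finite_family suc (fun a b h => by simpa using h) _
    · exact finite_family₂ app (fun a b c d h => by simpa using h) _
    · exact finite_family (fun t => app t (last t)) (fun a b h => by simpa using h) _
  have hl : (logSet hΔ).Finite := by
    refine ((Set.Finite.union ?_ ?_).union ?_).union ?_
    · exact finite_family (app .ident) (fun a b h => by simpa using h) _
    · exact finite_family (app .bot) (fun a b h => by simpa using h) _
    · refine (finite_family₂ (fun (p : BasicTerm × BasicTerm) α => app (.comp p.1 p.2) α)
        (fun a b c d h => by simpa [Prod.ext_iff] using h) fun p α h =>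
          eq ⟨app (.comp p.1 p.2) α, h⟩ ⟨app p.1 (app p.2 α), hΔ.comp h⟩).subset ?_
      rintro χ ⟨t, u, α, h, rfl⟩
      exact ⟨(t, u), α, h, rfl⟩
    · exact finite_family₂ (fun t u => app (.comp t u) (last (.comp t u)))
        (fun a b c d h => by simpa using h) _
  have hb : (boundsSet hΔ).Finite := by
    refine ((Set.Finite.union ?_ ?_).union ?_).union ?_
    · exact finite_family₂ (fun t α => app (.o t) α) (fun a b c d h => by simpa using h) _
    · exact finite_family₂ (fun t α => app (.o t) α) (fun a b c d h => by simpa using h) _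
    · exact finite_family (fun t => last (.o t)) (fun a b h => by simpa using h) _
    · have := finite_family₂ (Δ := Δ) app (fun a b c d h => by simpa using h) fun t α h =>
        {χ : tau.Formula Δ | ∃ k : app (.o t) (last (.o t)) ∈ Δ,
          χ = ((O ⟨app (.o t) (last (.o t)), k⟩).not ⊓ (O ⟨α, hΔ.arg h⟩).not).imp
            (O ⟨app t α, h⟩).not}
      refine (this.sUnion ?_).subset ?_
      · rintro s ⟨t, α, h, rfl⟩
        by_cases k : app (.o t) (last (.o t)) ∈ Δ
        · refine (Set.finite_singleton (((O ⟨app (.o t) (last (.o t)), k⟩).not ⊓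
            (O ⟨α, hΔ.arg h⟩).not).imp (O ⟨app t α, h⟩).not)).subset ?_
          rintro χ ⟨_, rfl⟩
          rfl
        · refine Set.finite_empty.subset ?_
          rintro χ ⟨k', _⟩
          exact k k'
      · rintro χ ⟨t, α, h, k, rfl⟩
        exact ⟨_, ⟨t, α, h, rfl⟩, k, rfl⟩
  have hr : (rightSet hΔ).Finite := by
    refine ((Set.Finite.union ?_ ?_).union ?_).union ?_
    · exact finite_family₂ (fun t α => app t (app (.r t) α)) (fun a b c d h => by simp_all) _
    · exact finite_family₂ (fun t α => app t (suc (app (.r t) α)))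
        (fun a b c d h => by simp_all) _
    · exact finite_family (fun t => app (.r t) (last (.r t))) (fun a b h => by simpa using h) _
    · exact finite_family (fun t => app t (suc (app (.r t) (last (.r t)))))
        (fun a b h => by simpa using h) _
  have hL : (leftSet hΔ).Finite := by
    refine (((Set.Finite.union ?_ ?_).union ?_).union ?_).union ?_
    · exact finite_family₂ (fun t α => app t (app (.l t) α)) (fun a b c d h => by simp_all) _
    · exact finite_family₂ (fun t α => app t (pre (app (.l t) α)))
        (fun a b c d h => by simp_all) _
    · exact finite_family₂ (fun t α => app t (app (.l t) α)) (fun a b c d h => by simp_all) _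
    · exact finite_family (fun t => app (.l t) (last (.l t))) (fun a b h => by simpa using h) _
    · exact finite_family (fun t => app (.l t) (last (.l t))) (fun a b h => by simpa using h) _
  have hf : (failSet hΔ κ ts).Finite := by
    refine (finite_family (fun t => app t (tvar κ)) (fun a b h => by simpa using h) fun t h =>
      lt ⟨app t (tvar κ), h⟩ ⟨tvar κ, hΔ.arg h⟩).subset ?_
    rintro χ ⟨t, _, h, rfl⟩
    exact ⟨t, h, rfl⟩
  exact ((((hs.union hl).union hb).union hr).union hL).union hf

end Sample

/-- The quantifier-free `τ`-formula `ψ`, with the samples in `Δ` as variables: the conjunction of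
the finite set `psiSet`. -/
noncomputable def psi (κ : ℕ) (ts : List BasicTerm) :
    tau.Formula (Sample.diagramDomain κ ts) :=
  have : Finite (Sample.psiSet (Sample.saturated_saturation _) κ ts :
      Set (tau.Formula (Sample.diagramDomain κ ts))) :=
    (Sample.psiSet_finite _ κ ts).to_subtype
  FirstOrder.Language.Formula.iInf
    fun χ : (Sample.psiSet (Sample.saturated_saturation _) κ ts :
      Set (tau.Formula (Sample.diagramDomain κ ts))) => χ.1

/-- The `σ`-formula `φ = ψ'`. -/
noncomputable def phi (κ : ℕ) (ts : List BasicTerm) :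
    sigma.Formula (Sample.diagramDomain κ ts) := tauToSigma (psi κ ts)

/-! ## Effectivity -/

/-- The bijection `ι : ℕ → ω ∪ {ω}`, `0 ↦ ω`, `n + 1 ↦ n`. -/
def iota : ℕ → ℕ∞
  | 0 => ⊤
  | n + 1 => (n : ℕ∞)

/-- The program `c` is an algorithmic description of the time warp `f`: it halts on every input and
computes `f`, elements of `ω ∪ {ω}` being represented by natural numbers through `ι`. -/
def Describes (c : Nat.Partrec.Code) (f : TimeWarp) : Prop :=
  ∀ m : ℕ, ∃ k ∈ c.eval m, iota k = f (iota m)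

/-- Gödel numbers of basic terms. -/
def BasicTerm.code : BasicTerm → ℕ
  | var x => Nat.pair 0 x
  | comp t u => Nat.pair 1 (Nat.pair t.code u.code)
  | o t => Nat.pair 2 t.code
  | l t => Nat.pair 3 t.code
  | r t => Nat.pair 4 t.code
  | ident => Nat.pair 5 0
  | bot => Nat.pair 6 0

/-- Gödel numbers of samples. -/
def Sample.code : Sample → ℕ
  | tvar κ => Nat.pair 0 κ
  | app t α => Nat.pair 1 (Nat.pair t.code α.code)
  | suc α => Nat.pair 2 α.code
  | pre α => Nat.pair 3 α.code
  | last t => Nat.pair 4 t.code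

/-- The list `G` enumerates the graph of `w : Δ → ℕ`, i.e. it presents `w` as a finite object. -/
def Enumerates {Δ : Set Sample} (G : List (Sample × ℕ)) (w : Δ → ℕ) : Prop :=
  ∀ (α : Sample) (k : ℕ), (α, k) ∈ G ↔ ∃ h : α ∈ Δ, w ⟨α, h⟩ = k

/-- The Gödel number version of a finite list of assignments. -/
def codeGraph (G : List (Sample × ℕ)) : List (ℕ × ℕ) := G.map fun e => (e.1.code, e.2)

/-!
If the join fails at `p` under some valuation, then evaluating all samples with `κ` at `p`
satisfies every conjunct of `ψ`. Conversely, `ψ` makes an assignment `δ` of `Δ` behave like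
evaluation. Each variable `x` is interpreted by the least time warp whose graph passes above the
points `(δ(α), δ(x[α]))`, a supremum of finitely many step functions, to which a shift of the
identity is added when `δ(last(x)) = ω`. By induction on terms, every basic term occurring in `Δ`
agrees with `δ`: the value of `last` decides properness, and the samples with `s` and `p` bracket
the values of the residuals. Hence the join still fails at `δ(κ)`. The supremum runs over a finite
list, so it is computable from the list.
-/

namespace TimeWarp

local notation:max f:max "ˡ" => TimeWarp.rdiv (sSupHom.id ℕ∞) f
local notation:max f:max "ʳ" => TimeWarp.ldiv f (sSupHom.id ℕ∞)
local notation:max f:max "ᵒ" => TimeWarp.ldiv TimeWarp.top f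

variable {f g h : TimeWarp} {p q : ℕ∞}

theorem apply_zero (f : TimeWarp) : f 0 = 0 := map_bot f

theorem apply_top_le_iff : f ⊤ ≤ q ↔ ∀ n : ℕ, f n ≤ q := by
  rw [← ENat.iSup_natCast, map_iSup, iSup_le_iff]

theorem natCast_le_apply_top_iff {m : ℕ} : (m : ℕ∞) ≤ f ⊤ ↔ ∃ n : ℕ, (m : ℕ∞) ≤ f n := by
  cases m with
  | zero => simp
  | succ m =>
    simp only [Nat.cast_add_one, ENat.natCast_add_one_le_iff]
    rw [← ENat.iSup_natCast, map_iSup, lt_iSup_iff]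

theorem exists_natCast_apply_eq_apply_top (hf : f ⊤ ≠ ⊤) : ∃ n : ℕ, f n = f ⊤ := by
  obtain ⟨m, hm⟩ := ENat.ne_top_iff_exists.1 hf
  obtain ⟨n, hn⟩ := natCast_le_apply_top_iff.1 hm.le
  exact ⟨n, (monotone f le_top).antisymm (hm ▸ hn)⟩

/-- The time warp with value `q` on the elements above `p` and `0` elsewhere. -/
noncomputable def step (p q : ℕ∞) : TimeWarp where
  toFun x := ⨆ _ : p < x, q
  map_sSup' S := by simp only [lt_sSup_iff, iSup_exists, iSup_and, sSup_image]

theorem step_apply (p q x : ℕ∞) : step p q x = ⨆ _ : p < x, q := rfl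

theorem comp_step (f : TimeWarp) (p q : ℕ∞) : sSupHom.comp f (step p q) = step p (f q) :=
  sSupHom.ext fun x => map_iSup f fun _ : p < x => q

theorem sub_one_lt_iff {x : ℕ∞} (hp₀ : p ≠ 0) (hp : p ≠ ⊤) : p - 1 < x ↔ p ≤ x := by
  lift p to ℕ using hp
  induction x using ENat.recTopCoe with
  | top => simp only [le_top, iff_true]; exact ENat.natCast_lt_top (p - 1)
  | coe x => norm_cast at hp₀ ⊢; omega

theorem step_sub_one_le_iff (hp₀ : p ≠ 0) (hp : p ≠ ⊤) : step (p - 1) q ≤ f ↔ q ≤ f p := by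
  refine ⟨fun hf => ?_, fun hq x => iSup_le fun hx => ?_⟩
  · exact (le_iSup (fun _ => q) ((sub_one_lt_iff hp₀ hp).2 le_rfl)).trans (hf p)
  · exact hq.trans (monotone f ((sub_one_lt_iff hp₀ hp).1 hx))

/-- The time warp `p ↦ p - N`, the truncated predecessor iterated `N` times. -/
noncomputable def shift (N : ℕ) : TimeWarp where
  toFun p := p - N
  map_sSup' S := by
    rw [GaloisConnection.l_sSup (u := (· + (N : ℕ∞))) fun _ _ => tsub_le_iff_right, sSup_image]

theorem top_apply (hp : p ≠ 0) : top p = ⊤ := by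
  have hstep : step 0 ⊤ p = ⊤ := iSup_pos (pos_iff_ne_zero.2 hp)
  exact top_unique (hstep.ge.trans ((le_sup (Set.mem_univ _) : step 0 ⊤ ≤ top) p))

theorem sup_apply_le_iff {A : Set TimeWarp} : sup A p ≤ q ↔ ∀ f ∈ A, f p ≤ q :=
  iSup₂_le_iff

theorem join_apply (f g : TimeWarp) (p : ℕ∞) : join f g p = f p ⊔ g p :=
  iSup_pair

section Residuals

theorem le_ldiv_apply_iff (hp₀ : p ≠ 0) (hp : p ≠ ⊤) : q ≤ ldiv f h p ↔ f q ≤ h p := by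
  rw [← step_sub_one_le_iff hp₀ hp, le_ldiv_iff, comp_step, step_sub_one_le_iff hp₀ hp]

theorem le_rdiv_apply_iff (hp₀ : p ≠ 0) (hp : p ≠ ⊤) :
    q ≤ rdiv h g p ↔ ∀ x, p ≤ g x → q ≤ h x := by
  rw [← step_sub_one_le_iff hp₀ hp, le_rdiv_iff]
  refine forall_congr' fun x => ?_
  rw [← sub_one_lt_iff hp₀ hp, ← iSup_le_iff]
  rfl

theorem top_apply_ldiv_top_apply_le (f : TimeWarp) (p : ℕ∞) : top (fᵒ p) ≤ f p :=
  (le_ldiv_iff top fᵒ f).1 le_rfl p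

theorem ldiv_top_apply_eq_zero (hf : f p ≠ ⊤) : fᵒ p = 0 := by
  by_contra hne
  exact hf (top_unique ((top_apply hne).ge.trans (top_apply_ldiv_top_apply_le f p)))

theorem ldiv_top_apply_eq_top (hp : p ≠ ⊤) (hf : f p = ⊤) : fᵒ p = ⊤ := by
  have hp₀ : p ≠ 0 := by
    rintro rfl
    exact ENat.zero_ne_top (f.apply_zero.symm.trans hf)
  exact top_unique ((le_ldiv_apply_iff hp₀ hp).2 (le_top.trans hf.ge))

theorem ldiv_top_apply_eq_zero_or_eq_top (f : TimeWarp) (p : ℕ∞) : fᵒ p = 0 ∨ fᵒ p = ⊤ := by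
  by_cases hf : ∃ q ≤ p, q ≠ ⊤ ∧ f q = ⊤
  · obtain ⟨q, hqp, hq, hfq⟩ := hf
    exact .inr (top_unique ((ldiv_top_apply_eq_top hq hfq).ge.trans (monotone _ hqp)))
  · push Not at hf
    have hzero : ∀ q ≤ p, q ≠ ⊤ → fᵒ q = 0 := fun q hqp hq =>
      ldiv_top_apply_eq_zero (hf q hqp hq)
    rcases eq_or_ne p ⊤ with rfl | hp
    · exact .inl (nonpos_iff_eq_zero.1 (apply_top_le_iff.2 fun n =>
        (hzero n le_top (ENat.natCast_ne_top n)).le))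
    · exact .inl (hzero p le_rfl hp)

theorem rdiv_id_apply_le (hq : p ≤ f q) : fˡ p ≤ q :=
  (monotone _ hq).trans ((le_rdiv_iff fˡ f _).1 le_rfl q)

theorem rdiv_id_apply_eq_sInf (hp₀ : p ≠ 0) (hp : p ≠ ⊤) : fˡ p = sInf {x | p ≤ f x} :=
  (le_sInf fun _ hx => rdiv_id_apply_le hx).antisymm
    ((le_rdiv_apply_iff hp₀ hp).2 fun _ hx => sInf_le hx)

theorem le_apply_rdiv_id_apply (hl : fˡ p ≠ ⊤) : p ≤ f (fˡ p) := by
  have hfin : ∀ n : ℕ, fˡ n ≠ ⊤ → n ≤ f (fˡ n) := fun n hn => by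
    rcases eq_or_ne n 0 with rfl | hn₀
    · exact zero_le
    · rw [rdiv_id_apply_eq_sInf (by exact_mod_cast hn₀) (ENat.natCast_ne_top n)] at hn ⊢
      have hne : {x | (n : ℕ∞) ≤ f x}.Nonempty := Set.nonempty_iff_ne_empty.2 fun he =>
        hn (by rw [he, sInf_empty])
      exact csInf_mem hne
  induction p using ENat.recTopCoe with
  | coe n => exact hfin n hl
  | top =>
    refine (ENat.eq_top_iff_forall_ge.2 fun n => ?_).ge
    have hle : fˡ n ≤ fˡ ⊤ := monotone _ le_top
    exact (hfin n (ne_top_of_le_ne_top hl hle)).trans (monotone f hle)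

theorem rdiv_id_apply_eq_top_iff (hp : p ≠ ⊤) : fˡ p = ⊤ ↔ f ⊤ < p := by
  refine ⟨fun hl => lt_of_not_ge fun hle => ?_, fun hlt => top_unique ?_⟩
  · lift p to ℕ using hp
    obtain ⟨n, hn⟩ := natCast_le_apply_top_iff.1 hle
    exact ENat.natCast_ne_top n (top_unique (hl.ge.trans (rdiv_id_apply_le hn)))
  · exact (le_rdiv_apply_iff hlt.ne_bot hp).2 fun x hx =>
      absurd hlt (hx.trans (monotone f le_top)).not_gt

theorem apply_rdiv_id_apply_sub_one_lt (hp₀ : p ≠ 0) (hl : fˡ p ≠ ⊤) : f (fˡ p - 1) < p := by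
  have hl₀ : fˡ p ≠ 0 := fun hl₀ => hp₀ (nonpos_iff_eq_zero.1 <| by
    simpa only [hl₀, apply_zero] using le_apply_rdiv_id_apply hl)
  by_contra! hle
  exact (rdiv_id_apply_le hle).not_gt ((sub_one_lt_iff hl₀ hl).2 le_rfl)

theorem apply_ldiv_id_apply_le (f : TimeWarp) (p : ℕ∞) : f (fʳ p) ≤ p :=
  (le_ldiv_iff f fʳ _).1 le_rfl p

theorem ldiv_id_apply_lt (hp : p < f q) : fʳ p < q :=
  lt_of_not_ge fun hq => hp.not_ge ((monotone f hq).trans (apply_ldiv_id_apply_le f p))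

theorem lt_apply_ldiv_id_apply_add_one (hp₀ : p ≠ 0) (hp : p ≠ ⊤) (hr : fʳ p ≠ ⊤) :
    p < f (fʳ p + 1) :=
  lt_of_not_ge fun hle =>
    lt_irrefl _ ((ENat.add_one_le_iff hr).1 ((le_ldiv_apply_iff hp₀ hp).2 hle))

theorem apply_ldiv_id_top_add_one (hr : fʳ ⊤ ≠ ⊤) : f (fʳ ⊤ + 1) = ⊤ := by
  refine ENat.eq_top_iff_forall_ge.2 fun n => le_of_not_gt fun hlt => ?_
  have hle : fʳ ⊤ + 1 ≤ fʳ n := (le_ldiv_apply_iff hlt.ne_bot (ENat.natCast_ne_top n)).2 hlt.le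
  exact lt_irrefl _ ((ENat.add_one_le_iff hr).1 (hle.trans (monotone _ le_top)))

theorem ldiv_id_apply_eq_top_iff (hp₀ : p ≠ 0) (hp : p ≠ ⊤) : fʳ p = ⊤ ↔ f ⊤ ≤ p := by
  rw [← top_le_iff, le_ldiv_apply_iff hp₀ hp]
  rfl

end Residuals

section Proper

/-- A time warp is proper if it attains the value `ω` at `ω` and nowhere else; these are the time
warps whose last value is attained at `ω` only. -/
structure Proper (f : TimeWarp) : Prop where
  apply_top : f ⊤ = ⊤
  apply_ne_top : ∀ p, p ≠ ⊤ → f p ≠ ⊤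

theorem proper_id : Proper (sSupHom.id ℕ∞) := ⟨rfl, fun _ hp => hp⟩

theorem proper_comp_iff : Proper (sSupHom.comp f g) ↔ Proper f ∧ Proper g := by
  refine ⟨fun hfg => ?_, fun ⟨hf, hg⟩ => ⟨?_, fun p hp => ?_⟩⟩
  · have hf : f ⊤ = ⊤ := top_unique (hfg.apply_top.ge.trans (monotone f le_top))
    have hg : g ⊤ = ⊤ := by
      by_contra hg
      obtain ⟨n, hn⟩ := exists_natCast_apply_eq_apply_top hg
      refine hfg.apply_ne_top n (ENat.natCast_ne_top n) ?_
      exact (congrArg f hn).trans hfg.apply_top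
    refine ⟨⟨hf, fun p hp hfp => ?_⟩, hg, fun p hp hgp => ?_⟩
    · lift p to ℕ using hp
      obtain ⟨n, hn⟩ := natCast_le_apply_top_iff.1 (le_top.trans hg.ge : (p : ℕ∞) ≤ g ⊤)
      exact hfg.apply_ne_top n (ENat.natCast_ne_top n) (top_unique (hfp.ge.trans (monotone f hn)))
    · exact hfg.apply_ne_top p hp ((congrArg f hgp).trans hf)
  · exact (congrArg f hg.apply_top).trans hf.apply_top
  · exact hf.apply_ne_top _ (hg.apply_ne_top p hp)

theorem not_proper_ldiv_top (f : TimeWarp) : ¬ Proper fᵒ := fun hf => by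
  have hle : fᵒ ⊤ ≤ 0 := apply_top_le_iff.2 fun n =>
    ((ldiv_top_apply_eq_zero_or_eq_top f n).resolve_right
      (hf.apply_ne_top n (ENat.natCast_ne_top n))).le
  exact absurd hf.apply_top (ne_top_of_le_ne_top ENat.zero_ne_top hle)

theorem ldiv_id_apply_top_eq_top_iff : fʳ ⊤ = ⊤ ↔ ∀ p, p ≠ ⊤ → f p ≠ ⊤ := by
  refine ⟨fun hr p hp hf => ?_, fun hf => by_contra fun hr => ?_⟩
  · have hle : fʳ ⊤ ≤ p := apply_top_le_iff.2 fun n =>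
      (ldiv_id_apply_lt (hf ▸ ENat.natCast_lt_top n)).le
    exact hp (top_unique (hr.ge.trans hle))
  · exact hf _ (by simpa using hr) (apply_ldiv_id_top_add_one hr)

theorem forall_ldiv_id_apply_ne_top_iff : (∀ p, p ≠ ⊤ → fʳ p ≠ ⊤) ↔ f ⊤ = ⊤ := by
  refine ⟨fun hr => by_contra fun hf => ?_, fun hf p hp hr => ?_⟩
  · have hsucc : f ⊤ + 1 ≠ ⊤ := by simpa using hf
    exact hr _ hsucc ((ldiv_id_apply_eq_top_iff (by simp) hsucc).2 le_self_add)
  · rcases eq_or_ne p 0 with rfl | hp₀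
    · exact ENat.zero_ne_top (fʳ.apply_zero.symm.trans hr)
    · exact hp (top_unique (hf ▸ (ldiv_id_apply_eq_top_iff hp₀ hp).1 hr))

theorem proper_ldiv_id_iff : Proper fʳ ↔ Proper f :=
  ⟨fun hr => ⟨forall_ldiv_id_apply_ne_top_iff.1 hr.apply_ne_top,
    ldiv_id_apply_top_eq_top_iff.1 hr.apply_top⟩,
  fun hf => ⟨ldiv_id_apply_top_eq_top_iff.2 hf.apply_ne_top,
    forall_ldiv_id_apply_ne_top_iff.2 hf.apply_top⟩⟩

theorem rdiv_id_apply_top_eq_top_iff : fˡ ⊤ = ⊤ ↔ ∀ p, p ≠ ⊤ → f p ≠ ⊤ := by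
  refine ⟨fun hl p hp hf => ?_, fun hf => by_contra fun hl => ?_⟩
  · exact hp (top_unique (hl.ge.trans (rdiv_id_apply_le hf.ge)))
  · exact hf _ hl (top_unique (le_apply_rdiv_id_apply hl))

theorem forall_rdiv_id_apply_ne_top_iff : (∀ p, p ≠ ⊤ → fˡ p ≠ ⊤) ↔ f ⊤ = ⊤ := by
  refine ⟨fun hl => by_contra fun hf => ?_, fun hf p hp hl => ?_⟩
  · have hsucc : f ⊤ + 1 ≠ ⊤ := by simpa using hf
    exact hl _ hsucc ((rdiv_id_apply_eq_top_iff hsucc).2 ((ENat.lt_add_one_iff hf).2 le_rfl))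
  · exact not_top_lt (hf ▸ (rdiv_id_apply_eq_top_iff hp).1 hl)

theorem proper_rdiv_id_iff : Proper fˡ ↔ Proper f :=
  ⟨fun hl => ⟨forall_rdiv_id_apply_ne_top_iff.1 hl.apply_ne_top,
    rdiv_id_apply_top_eq_top_iff.1 hl.apply_top⟩,
  fun hf => ⟨rdiv_id_apply_top_eq_top_iff.2 hf.apply_ne_top,
    forall_rdiv_id_apply_ne_top_iff.2 hf.apply_top⟩⟩

/-- The least point at which `f` attains its last value `f ω`, the meaning of `last(t)`. -/
noncomputable def lastPoint (f : TimeWarp) : ℕ∞ := sInf {p | f p = f ⊤}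

theorem apply_lastPoint (f : TimeWarp) : f (lastPoint f) = f ⊤ :=
  csInf_mem (s := {p | f p = f ⊤}) ⟨⊤, rfl⟩

theorem lastPoint_le_iff : lastPoint f ≤ p ↔ f p = f ⊤ :=
  ⟨fun hp => (monotone f le_top).antisymm ((apply_lastPoint f).ge.trans (monotone f hp)),
    fun hp => sInf_le hp⟩

theorem lastPoint_eq_top_iff : lastPoint f = ⊤ ↔ Proper f := by
  refine ⟨fun hlast => ?_, fun hf => by_contra fun hlast => ?_⟩
  · have hne : ∀ p, p ≠ ⊤ → f p ≠ f ⊤ := fun p hp hfp =>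
      hp (top_unique (hlast.ge.trans (lastPoint_le_iff.2 hfp)))
    have htop : f ⊤ = ⊤ := by_contra fun hf => by
      obtain ⟨n, hn⟩ := exists_natCast_apply_eq_apply_top hf
      exact hne n (ENat.natCast_ne_top n) hn
    exact ⟨htop, fun p hp => htop ▸ hne p hp⟩
  · exact hf.apply_ne_top _ hlast ((apply_lastPoint f).trans hf.apply_top)

end Proper

end TimeWarp

open FirstOrder.Language

theorem iota_injective : Function.Injective iota := by
  rintro (_ | m) (_ | n) h
  · rfl
  · exact absurd h.symm (ENat.natCast_ne_top n)
  · exact absurd h (ENat.natCast_ne_top m)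
  · rw [Nat.cast_injective (R := ℕ∞) h]

theorem iota_surjective : Function.Surjective iota := fun p => by
  induction p using ENat.recTopCoe with
  | top => exact ⟨0, rfl⟩
  | coe n => exact ⟨n + 1, rfl⟩

theorem iota_eq_top_iff {m : ℕ} : iota m = ⊤ ↔ m = 0 :=
  iota_injective.eq_iff (b := 0)

theorem iota_eq_zero_iff {m : ℕ} : iota m = 0 ↔ m = 1 :=
  iota_injective.eq_iff (b := 1)

theorem iota_le_iff {m n : ℕ} : iota m ≤ iota n ↔ n = 0 ∨ m ≠ 0 ∧ m ≤ n := by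
  rcases m with _ | m <;> rcases n with _ | n <;> simp [iota]

theorem iota_eq_add_one_iff {m n : ℕ} :
    iota n = iota m + 1 ↔ m = 0 ∧ n = 0 ∨ m ≠ 0 ∧ n = m + 1 := by
  obtain _ | m := m
  · simpa [iota] using iota_eq_top_iff
  · simpa [iota] using iota_injective.eq_iff (a := n) (b := m + 2)

/-- The `τ`-structure of `ω ∪ {ω}` transported to `ℕ` along `ι`: the semantics of `τ` in which a
`τ`-formula holds exactly when its translation holds in the `σ`-structure `ℕ`. -/
instance tauNat : tau.Structure ℕ where
  funMap f _ := nomatch f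
  RelMap R v := match R, v with
    | .I, v => iota (v 0) = 0
    | .O, v => iota (v 0) = ⊤
    | .le, v => iota (v 0) ≤ iota (v 1)
    | .S, v => iota (v 1) = iota (v 0) + 1

section Realize

variable {V : Type}

section Atoms

variable (w : V → ℕ) (x y : V)

@[simp]
theorem realize_tau_I : (tau.I x).Realize w ↔ iota (w x) = 0 := Iff.rfl

@[simp]
theorem realize_tau_O : (tau.O x).Realize w ↔ iota (w x) = ⊤ := Iff.rfl

@[simp]
theorem realize_tau_S : (tau.S x y).Realize w ↔ iota (w y) = iota (w x) + 1 := Iff.rfl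

@[simp]
theorem realize_tau_le : (tau.le x y).Realize w ↔ iota (w x) ≤ iota (w y) := Iff.rfl

@[simp]
theorem realize_tau_eq : (tau.eq x y).Realize w ↔ iota (w x) = iota (w y) :=
  (Iff.rfl : _ ↔ w x = w y).trans iota_injective.eq_iff.symm

@[simp]
theorem realize_tau_lt : (tau.lt x y).Realize w ↔ iota (w x) < iota (w y) := by
  rw [lt_iff_le_not_ge, tau.lt, Formula.realize_inf, Formula.realize_not, realize_tau_le,
    realize_tau_le]

end Atoms

theorem realize_tauTermToSigma (v : V → ℕ) (t : tau.Term V) :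
    (tauTermToSigma t).realize v = t.realize v := by
  cases t with
  | var x => rfl
  | func f _ => exact nomatch f

theorem realize_tauAtomToSigma {n l : ℕ} (R : TauRel l) (ts : Fin l → sigma.Term (V ⊕ Fin n))
    (v : V → ℕ) (xs : Fin n → ℕ) :
    (tauAtomToSigma R ts).Realize v xs ↔
      tauNat.RelMap R fun i => (ts i).realize (Sum.elim v xs) := by
  cases R with
  | I => exact iota_eq_zero_iff.symm
  | O => exact iota_eq_top_iff.symm
  | le =>
    rw [tauAtomToSigma, BoundedFormula.realize_sup, BoundedFormula.realize_inf,
      BoundedFormula.realize_not]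
    exact iota_le_iff.symm
  | S =>
    rw [tauAtomToSigma, BoundedFormula.realize_sup, BoundedFormula.realize_inf,
      BoundedFormula.realize_inf, BoundedFormula.realize_not]
    exact iota_eq_add_one_iff.symm

theorem realize_tauToSigma {n : ℕ} (χ : tau.BoundedFormula V n) (v : V → ℕ) :
    ∀ xs : Fin n → ℕ, (tauToSigma χ).Realize v xs ↔ χ.Realize v xs := by
  induction χ with
  | falsum => exact fun xs => Iff.rfl
  | equal s t =>
    intro xs
    exact Eq.congr (realize_tauTermToSigma _ s) (realize_tauTermToSigma _ t)
  | rel R ts =>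
    intro xs
    exact (realize_tauAtomToSigma R _ v xs).trans (iff_of_eq
      (congrArg (tauNat.RelMap R) (funext fun i => realize_tauTermToSigma _ (ts i))))
  | imp χ₁ χ₂ ih₁ ih₂ => exact fun xs => imp_congr (ih₁ xs) (ih₂ xs)
  | all χ ih => exact fun xs => forall_congr' fun a => ih _

theorem realize_phi_iff {κ : ℕ} {ts : List BasicTerm} {w : Sample.diagramDomain κ ts → ℕ} :
    (phi κ ts).Realize w ↔
      ∀ χ ∈ Sample.psiSet (Sample.saturated_saturation _) κ ts, χ.Realize w := by
  have : Finite (Sample.psiSet (Sample.saturated_saturation _) κ ts :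
      Set (tau.Formula (Sample.diagramDomain κ ts))) :=
    (Sample.psiSet_finite _ κ ts).to_subtype
  exact (realize_tauToSigma _ _ _).trans ((Formula.realize_iInf (M := ℕ)).trans Subtype.forall)

end Realize

section QuantifierFree

theorem isQF_iff {L : FirstOrder.Language} {V : Type*} {n : ℕ} {χ ξ : L.BoundedFormula V n}
    (hχ : χ.IsQF) (hξ : ξ.IsQF) : (χ.iff ξ).IsQF :=
  (hχ.imp hξ).inf (hξ.imp hχ)

theorem isQF_iInf {L : FirstOrder.Language} {V B : Type*} {n : ℕ} [Finite B]
    {f : B → L.BoundedFormula V n} (hf : ∀ b, (f b).IsQF) : (BoundedFormula.iInf f).IsQF := by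
  have hfold : ∀ l : List B, ((l.map f).foldr (· ⊓ ·) ⊤).IsQF := fun l => by
    induction l with
    | nil => exact .top
    | cons b l ih => exact (hf b).inf ih
  exact hfold _

theorem isQF_tauAtomToSigma {V : Type} {n l : ℕ} (R : TauRel l)
    (ts : Fin l → sigma.Term (V ⊕ Fin n)) : (tauAtomToSigma R ts).IsQF := by
  have equal (s t : sigma.Term (V ⊕ Fin n)) : (BoundedFormula.equal s t).IsQF :=
    .of_isAtomic (.equal s t)
  cases R with
  | I => exact .of_isAtomic (.rel _ _)
  | O => exact equal _ _
  | le => exact (equal _ _).sup ((equal _ _).not.inf (.of_isAtomic (.rel _ _)))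
  | S => exact ((equal _ _).inf (equal _ _)).sup ((equal _ _).not.inf (.of_isAtomic (.rel _ _)))

theorem isQF_tauToSigma {V : Type} {n : ℕ} {χ : tau.BoundedFormula V n} (hχ : χ.IsQF) :
    (tauToSigma χ).IsQF := by
  induction hχ with
  | falsum => exact .falsum
  | of_isAtomic hχ =>
    cases hχ with
    | equal s t => exact .of_isAtomic (.equal _ _)
    | rel R ts => exact isQF_tauAtomToSigma R _
  | imp _ _ ih₁ ih₂ => exact ih₁.imp ih₂

namespace tau

variable {V : Type} (x y : V)

theorem isQF_I : (I x).IsQF := .of_isAtomic (.rel _ _)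

theorem isQF_O : (O x).IsQF := .of_isAtomic (.rel _ _)

theorem isQF_S : (S x y).IsQF := .of_isAtomic (.rel _ _)

theorem isQF_le : (le x y).IsQF := .of_isAtomic (.rel _ _)

theorem isQF_eq : (eq x y).IsQF := .of_isAtomic (.equal _ _)

theorem isQF_lt : (lt x y).IsQF := (isQF_le x y).inf (isQF_le y x).not

end tau

namespace Sample

open tau

variable {Δ : Set Sample} {hΔ : Saturated Δ} {χ : tau.Formula Δ}

theorem isQF_of_mem_structSet (hχ : χ ∈ structSet hΔ) : χ.IsQF := by
  rcases hχ with ((((⟨t, α, β, h, k, rfl⟩ | ⟨t, α, h, rfl⟩) | ⟨α, h, rfl⟩) | ⟨α, h, rfl⟩) |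
    ⟨t, α, h, rfl⟩) | ⟨t, h, rfl⟩
  · exact (isQF_le _ _).imp (isQF_le _ _)
  · exact (isQF_I _).imp (isQF_I _)
  · exact (isQF_S _ _).sup ((isQF_I _).inf (isQF_I _))
  · exact isQF_S _ _
  · exact isQF_iff (isQF_le _ _) (isQF_eq _ _)
  · exact (isQF_O _).imp (isQF_O _)

theorem isQF_of_mem_logSet (hχ : χ ∈ logSet hΔ) : χ.IsQF := by
  rcases hχ with ((⟨α, h, rfl⟩ | ⟨α, h, rfl⟩) | ⟨t, u, α, h, rfl⟩) | ⟨t, u, h, rfl⟩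
  · exact isQF_eq _ _
  · exact isQF_I _
  · exact isQF_eq _ _
  · exact (isQF_O _).imp ((isQF_O _).inf (isQF_O _))

theorem isQF_of_mem_boundsSet (hχ : χ ∈ boundsSet hΔ) : χ.IsQF := by
  rcases hχ with ((⟨t, α, h, rfl⟩ | ⟨t, α, h, rfl⟩) | ⟨t, h, rfl⟩) | ⟨t, α, h, k, rfl⟩
  · exact (isQF_I _).sup (isQF_O _)
  · exact (isQF_O _).not.imp (isQF_iff (isQF_O _) (isQF_O _))
  · exact (isQF_O _).not
  · exact ((isQF_O _).not.inf (isQF_O _).not).imp (isQF_O _).not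

theorem isQF_of_mem_rightSet (hχ : χ ∈ rightSet hΔ) : χ.IsQF := by
  rcases hχ with ((⟨t, α, h, rfl⟩ | ⟨t, α, h, rfl⟩) | ⟨t, h, rfl⟩) | ⟨t, h, rfl⟩
  · exact isQF_le _ _
  · exact (((isQF_I _).not.inf (isQF_O _).not).inf (isQF_O _).not).imp (isQF_lt _ _)
  · exact (isQF_O _).imp (isQF_O _)
  · exact (isQF_O _).not.imp (isQF_O _)

theorem isQF_of_mem_leftSet (hχ : χ ∈ leftSet hΔ) : χ.IsQF := by
  rcases hχ with (((⟨t, α, h, rfl⟩ | ⟨t, α, h, rfl⟩) | ⟨t, α, h, rfl⟩) | ⟨t, h, rfl⟩) | ⟨t, h, rfl⟩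
  · exact (isQF_O _).not.imp (isQF_le _ _)
  · exact (((isQF_I _).not.inf (isQF_O _).not).inf (isQF_O _).not).imp (isQF_lt _ _)
  · exact ((isQF_O _).not.inf (isQF_O _)).imp (isQF_lt _ _)
  · exact (isQF_O _).imp (isQF_O _)
  · exact (isQF_O _).not.imp (isQF_O _)

theorem isQF_of_mem_psiSet {κ : ℕ} {ts : List BasicTerm} (hχ : χ ∈ psiSet hΔ κ ts) : χ.IsQF := by
  rcases hχ with ((((hχ | hχ) | hχ) | hχ) | hχ) | ⟨t, _, h, rfl⟩
  · exact isQF_of_mem_structSet hχ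
  · exact isQF_of_mem_logSet hχ
  · exact isQF_of_mem_boundsSet hχ
  · exact isQF_of_mem_rightSet hχ
  · exact isQF_of_mem_leftSet hχ
  · exact isQF_lt _ _

end Sample

theorem isQF_phi (κ : ℕ) (ts : List BasicTerm) : (phi κ ts).IsQF :=
  have : Finite (Sample.psiSet (Sample.saturated_saturation _) κ ts :
      Set (tau.Formula (Sample.diagramDomain κ ts))) :=
    (Sample.psiSet_finite _ κ ts).to_subtype
  isQF_tauToSigma (isQF_iInf fun χ => Sample.isQF_of_mem_psiSet χ.2)

end QuantifierFree

namespace Sample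

/-- The conditions that the structure conjuncts of `ψ` impose on `δ : Δ → ω ∪ {ω}`. As in the other
parts of `IsDiagram`, `δ` is a total function, of which only the restriction to `Δ` matters. -/
structure StructLaws (Δ : Set Sample) (δ : Sample → ℕ∞) : Prop where
  mono : ∀ {t α β}, app t α ∈ Δ → app t β ∈ Δ → δ α ≤ δ β → δ (app t α) ≤ δ (app t β)
  app_zero : ∀ {t α}, app t α ∈ Δ → δ α = 0 → δ (app t α) = 0
  pre : ∀ {α}, pre α ∈ Δ → δ α = δ (pre α) + 1 ∨ δ (pre α) = 0 ∧ δ α = 0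
  suc : ∀ {α}, suc α ∈ Δ → δ (suc α) = δ α + 1
  last_le : ∀ {t α}, app t α ∈ Δ → (δ (last t) ≤ δ α ↔ δ (app t α) = δ (app t (last t)))
  app_last : ∀ {t}, app t (last t) ∈ Δ → δ (last t) = ⊤ → δ (app t (last t)) = ⊤

/-- The conditions that the logic conjuncts of `ψ` impose on `δ`. -/
structure LogicLaws (Δ : Set Sample) (δ : Sample → ℕ∞) : Prop where
  ident : ∀ {α}, app .ident α ∈ Δ → δ (app .ident α) = δ α
  last_bot : ∀ {α}, app .bot α ∈ Δ → δ (last .bot) = 0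
  comp : ∀ {t u α}, app (.comp t u) α ∈ Δ → δ (app (.comp t u) α) = δ (app t (app u α))
  last_comp : ∀ {t u}, app (.comp t u) (last (.comp t u)) ∈ Δ → δ (last (.comp t u)) = ⊤ →
    δ (last t) = ⊤ ∧ δ (last u) = ⊤

/-- The conditions that the bounds conjuncts of `ψ` impose on `δ`. -/
structure BoundsLaws (Δ : Set Sample) (δ : Sample → ℕ∞) : Prop where
  o_zero_or_top : ∀ {t α}, app (.o t) α ∈ Δ → δ (app (.o t) α) = 0 ∨ δ (app (.o t) α) = ⊤
  o_eq_top_iff : ∀ {t α}, app (.o t) α ∈ Δ → δ α ≠ ⊤ → (δ (app (.o t) α) = ⊤ ↔ δ (app t α) = ⊤)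
  last_o : ∀ {t}, last (.o t) ∈ Δ → δ (last (.o t)) ≠ ⊤
  o_last : ∀ {t α}, app t α ∈ Δ → app (.o t) (last (.o t)) ∈ Δ →
    δ (app (.o t) (last (.o t))) ≠ ⊤ → δ α ≠ ⊤ → δ (app t α) ≠ ⊤

/-- The conditions that the right conjuncts of `ψ` impose on `δ`. -/
structure RightLaws (Δ : Set Sample) (δ : Sample → ℕ∞) : Prop where
  app_r_le : ∀ {t α}, app t (app (.r t) α) ∈ Δ → δ (app t (app (.r t) α)) ≤ δ α
  lt_app_suc_r : ∀ {t α}, app t (.suc (app (.r t) α)) ∈ Δ → δ α ≠ 0 → δ α ≠ ⊤ →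
    δ (app (.r t) α) ≠ ⊤ → δ α < δ (app t (.suc (app (.r t) α)))
  last_r : ∀ {t}, app (.r t) (last (.r t)) ∈ Δ → δ (last (.r t)) = ⊤ → δ (last t) = ⊤
  app_suc_r_last : ∀ {t}, app t (.suc (app (.r t) (last (.r t)))) ∈ Δ →
    δ (app (.r t) (last (.r t))) ≠ ⊤ → δ (app t (.suc (app (.r t) (last (.r t))))) = ⊤

/-- The conditions that the left conjuncts of `ψ` impose on `δ`. -/
structure LeftLaws (Δ : Set Sample) (δ : Sample → ℕ∞) : Prop where
  le_app_l : ∀ {t α}, app t (app (.l t) α) ∈ Δ → δ (app (.l t) α) ≠ ⊤ →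
    δ α ≤ δ (app t (app (.l t) α))
  app_pre_l_lt : ∀ {t α}, app t (.pre (app (.l t) α)) ∈ Δ → δ α ≠ 0 → δ α ≠ ⊤ →
    δ (app (.l t) α) ≠ ⊤ → δ (app t (.pre (app (.l t) α))) < δ α
  app_l_lt : ∀ {t α}, app t (app (.l t) α) ∈ Δ → δ α ≠ ⊤ → δ (app (.l t) α) = ⊤ →
    δ (app t (app (.l t) α)) < δ α
  last_l : ∀ {t}, app (.l t) (last (.l t)) ∈ Δ → δ (last (.l t)) = ⊤ → δ (last t) = ⊤
  app_l_last : ∀ {t}, app (.l t) (last (.l t)) ∈ Δ → δ (app (.l t) (last (.l t))) ≠ ⊤ →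
    δ (app t (app (.l t) (last (.l t)))) = ⊤

/-- A diagram on `Δ`: an assignment of elements of `ω ∪ {ω}` to the samples in `Δ` that satisfies
every conjunct of `ψ` except those expressing failure. -/
structure IsDiagram (Δ : Set Sample) (δ : Sample → ℕ∞) : Prop extends
  StructLaws Δ δ, LogicLaws Δ δ, BoundsLaws Δ δ, RightLaws Δ δ, LeftLaws Δ δ

section RealizePsi

variable {Δ : Set Sample} (hΔ : Saturated Δ) {w : Δ → ℕ} {δ : Sample → ℕ∞}
  (hδ : ∀ a : Δ, iota (w a) = δ a)

include hδ

theorem realize_structSet_iff : (∀ χ ∈ structSet hΔ, χ.Realize w) ↔ StructLaws Δ δ := by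
  refine ⟨fun H => ?_, fun D => ?_⟩
  · exact
    { mono := fun h k => by
        simpa [hδ] using H _ (.inl (.inl (.inl (.inl (.inl ⟨_, _, _, h, k, rfl⟩)))))
      app_zero := fun h => by
        simpa [hδ] using H _ (.inl (.inl (.inl (.inl (.inr ⟨_, _, h, rfl⟩)))))
      pre := fun h => by simpa [hδ] using H _ (.inl (.inl (.inl (.inr ⟨_, h, rfl⟩))))
      suc := fun h => by simpa [hδ] using H _ (.inl (.inl (.inr ⟨_, h, rfl⟩)))
      last_le := fun h => by simpa [hδ] using H _ (.inl (.inr ⟨_, _, h, rfl⟩))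
      app_last := fun h => by simpa [hδ] using H _ (.inr ⟨_, h, rfl⟩) }
  · rintro χ (((((⟨t, α, β, h, k, rfl⟩ | ⟨t, α, h, rfl⟩) | ⟨α, h, rfl⟩) | ⟨α, h, rfl⟩) |
      ⟨t, α, h, rfl⟩) | ⟨t, h, rfl⟩)
    · simpa [hδ] using D.mono h k
    · simpa [hδ] using D.app_zero h
    · simpa [hδ] using D.pre h
    · simpa [hδ] using D.suc h
    · simpa [hδ] using D.last_le h
    · simpa [hδ] using D.app_last h

theorem realize_logSet_iff : (∀ χ ∈ logSet hΔ, χ.Realize w) ↔ LogicLaws Δ δ := by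
  refine ⟨fun H => ?_, fun D => ?_⟩
  · exact
    { ident := fun h => by simpa [hδ] using H _ (.inl (.inl (.inl ⟨_, h, rfl⟩)))
      last_bot := fun h => by simpa [hδ] using H _ (.inl (.inl (.inr ⟨_, h, rfl⟩)))
      comp := fun h => by simpa [hδ] using H _ (.inl (.inr ⟨_, _, _, h, rfl⟩))
      last_comp := fun h => by simpa [hδ] using H _ (.inr ⟨_, _, h, rfl⟩) }
  · rintro χ (((⟨α, h, rfl⟩ | ⟨α, h, rfl⟩) | ⟨t, u, α, h, rfl⟩) | ⟨t, u, h, rfl⟩)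
    · simpa [hδ] using D.ident h
    · simpa [hδ] using D.last_bot h
    · simpa [hδ] using D.comp h
    · simpa [hδ] using D.last_comp h

theorem realize_boundsSet_iff : (∀ χ ∈ boundsSet hΔ, χ.Realize w) ↔ BoundsLaws Δ δ := by
  refine ⟨fun H => ?_, fun D => ?_⟩
  · exact
    { o_zero_or_top := fun h => by simpa [hδ] using H _ (.inl (.inl (.inl ⟨_, _, h, rfl⟩)))
      o_eq_top_iff := fun h => by simpa [hδ] using H _ (.inl (.inl (.inr ⟨_, _, h, rfl⟩)))
      last_o := fun h => by simpa [hδ] using H _ (.inl (.inr ⟨_, h, rfl⟩))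
      o_last := fun h k => by simpa [hδ] using H _ (.inr ⟨_, _, h, k, rfl⟩) }
  · rintro χ (((⟨t, α, h, rfl⟩ | ⟨t, α, h, rfl⟩) | ⟨t, h, rfl⟩) | ⟨t, α, h, k, rfl⟩)
    · simpa [hδ] using D.o_zero_or_top h
    · simpa [hδ] using D.o_eq_top_iff h
    · simpa [hδ] using D.last_o h
    · simpa [hδ] using D.o_last h k

theorem realize_rightSet_iff : (∀ χ ∈ rightSet hΔ, χ.Realize w) ↔ RightLaws Δ δ := by
  refine ⟨fun H => ?_, fun D => ?_⟩
  · exact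
    { app_r_le := fun h => by simpa [hδ] using H _ (.inl (.inl (.inl ⟨_, _, h, rfl⟩)))
      lt_app_suc_r := fun h => by simpa [hδ] using H _ (.inl (.inl (.inr ⟨_, _, h, rfl⟩)))
      last_r := fun h => by simpa [hδ] using H _ (.inl (.inr ⟨_, h, rfl⟩))
      app_suc_r_last := fun h => by simpa [hδ] using H _ (.inr ⟨_, h, rfl⟩) }
  · rintro χ (((⟨t, α, h, rfl⟩ | ⟨t, α, h, rfl⟩) | ⟨t, h, rfl⟩) | ⟨t, h, rfl⟩)
    · simpa [hδ] using D.app_r_le h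
    · simpa [hδ] using D.lt_app_suc_r h
    · simpa [hδ] using D.last_r h
    · simpa [hδ] using D.app_suc_r_last h

theorem realize_leftSet_iff : (∀ χ ∈ leftSet hΔ, χ.Realize w) ↔ LeftLaws Δ δ := by
  refine ⟨fun H => ?_, fun D => ?_⟩
  · exact
    { le_app_l := fun h => by simpa [hδ] using H _ (.inl (.inl (.inl (.inl ⟨_, _, h, rfl⟩))))
      app_pre_l_lt := fun h => by simpa [hδ] using H _ (.inl (.inl (.inl (.inr ⟨_, _, h, rfl⟩))))
      app_l_lt := fun h => by simpa [hδ] using H _ (.inl (.inl (.inr ⟨_, _, h, rfl⟩)))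
      last_l := fun h => by simpa [hδ] using H _ (.inl (.inr ⟨_, h, rfl⟩))
      app_l_last := fun h => by simpa [hδ] using H _ (.inr ⟨_, h, rfl⟩) }
  · rintro χ ((((⟨t, α, h, rfl⟩ | ⟨t, α, h, rfl⟩) | ⟨t, α, h, rfl⟩) | ⟨t, h, rfl⟩) | ⟨t, h, rfl⟩)
    · simpa [hδ] using D.le_app_l h
    · simpa [hδ] using D.app_pre_l_lt h
    · simpa [hδ] using D.app_l_lt h
    · simpa [hδ] using D.last_l h
    · simpa [hδ] using D.app_l_last h

theorem realize_failSet_iff {κ : ℕ} {ts : List BasicTerm} :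
    (∀ χ ∈ failSet hΔ κ ts, χ.Realize w) ↔
      ∀ t ∈ ts, app t (tvar κ) ∈ Δ → δ (app t (tvar κ)) < δ (tvar κ) := by
  refine ⟨fun H t ht h => ?_, ?_⟩
  · simpa [hδ] using H _ ⟨t, ht, h, rfl⟩
  · rintro H χ ⟨t, ht, h, rfl⟩
    simpa [hδ] using H t ht h

theorem realize_psiSet_iff {κ : ℕ} {ts : List BasicTerm} :
    (∀ χ ∈ psiSet hΔ κ ts, χ.Realize w) ↔ IsDiagram Δ δ ∧
      ∀ t ∈ ts, app t (tvar κ) ∈ Δ → δ (app t (tvar κ)) < δ (tvar κ) := by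
  simp only [psiSet, Set.mem_union, or_imp, forall_and, realize_structSet_iff hΔ hδ,
    realize_logSet_iff hΔ hδ, realize_boundsSet_iff hΔ hδ, realize_rightSet_iff hΔ hδ,
    realize_leftSet_iff hΔ hδ, realize_failSet_iff hΔ hδ]
  exact and_congr_left' ⟨fun ⟨⟨⟨⟨hs, hg⟩, hb⟩, hr⟩, hl⟩ => ⟨hs, hg, hb, hr, hl⟩,
    fun ⟨hs, hg, hb, hr, hl⟩ => ⟨⟨⟨⟨hs, hg⟩, hb⟩, hr⟩, hl⟩⟩

end RealizePsi

section Value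

open TimeWarp

/-- The value of a sample when its term variables are interpreted by `θ` and all its time variables
by `p`. -/
noncomputable def value (θ : ℕ → TimeWarp) (p : ℕ∞) : Sample → ℕ∞
  | tvar _ => p
  | app t α => t.toTerm.eval θ (value θ p α)
  | suc α => value θ p α + 1
  | pre α => value θ p α - 1
  | last t => lastPoint (t.toTerm.eval θ)

variable (Δ : Set Sample) (θ : ℕ → TimeWarp) (p : ℕ∞)

theorem value_app_last (t : BasicTerm) :
    value θ p (app t (last t)) = t.toTerm.eval θ ⊤ :=
  apply_lastPoint _

theorem value_last_eq_top_iff (t : BasicTerm) :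
    value θ p (last t) = ⊤ ↔ Proper (t.toTerm.eval θ) :=
  lastPoint_eq_top_iff

theorem structLaws_value : StructLaws Δ (value θ p) where
  mono _ _ h := monotone _ h
  app_zero {t α} _ h := (congrArg (t.toTerm.eval θ) h).trans (apply_zero _)
  pre {α} _ := by
    change value θ p α = value θ p α - 1 + 1 ∨ value θ p α - 1 = 0 ∧ value θ p α = 0
    rcases eq_or_ne (value θ p α) 0 with h | h
    · exact .inr (by simp only [h, zero_tsub, and_self])
    · exact .inl (tsub_add_cancel_of_le (Order.one_le_iff_ne_zero.2 h)).symm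
  suc _ := rfl
  last_le {t α} _ := by
    rw [value_app_last]
    exact lastPoint_le_iff
  app_last {t} _ h := by
    rw [value_app_last]
    exact ((value_last_eq_top_iff θ p t).1 h).apply_top

theorem logicLaws_value : LogicLaws Δ (value θ p) where
  ident _ := rfl
  last_bot _ := nonpos_iff_eq_zero.1 (lastPoint_le_iff.2 rfl)
  comp _ := rfl
  last_comp {t u} _ h := by
    rw [value_last_eq_top_iff, value_last_eq_top_iff]
    exact proper_comp_iff.1 ((value_last_eq_top_iff θ p _).1 h)

theorem boundsLaws_value : BoundsLaws Δ (value θ p) where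
  o_zero_or_top _ := ldiv_top_apply_eq_zero_or_eq_top _ _
  o_eq_top_iff {t α} _ hα := by
    refine ⟨fun ho => by_contra fun ht => ?_, ldiv_top_apply_eq_top hα⟩
    exact ENat.zero_ne_top ((ldiv_top_apply_eq_zero ht).symm.trans ho)
  last_o {t} _ h := not_proper_ldiv_top _ ((value_last_eq_top_iff θ p _).1 h)
  o_last {t α} _ _ ho hα ht := by
    rw [value_app_last] at ho
    exact ho (top_unique ((ldiv_top_apply_eq_top hα ht).ge.trans (monotone _ le_top)))

theorem rightLaws_value : RightLaws Δ (value θ p) where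
  app_r_le _ := apply_ldiv_id_apply_le _ _
  lt_app_suc_r _ h₀ hα hr := lt_apply_ldiv_id_apply_add_one h₀ hα hr
  last_r {t} _ h := by
    rw [value_last_eq_top_iff] at h ⊢
    exact proper_ldiv_id_iff.1 h
  app_suc_r_last {t} _ h := by
    change t.toTerm.eval θ (value θ p (app (.r t) (last (.r t))) + 1) = ⊤
    rw [value_app_last] at h ⊢
    exact apply_ldiv_id_top_add_one h

theorem leftLaws_value : LeftLaws Δ (value θ p) where
  le_app_l _ hl := le_apply_rdiv_id_apply hl
  app_pre_l_lt _ h₀ _ hl := apply_rdiv_id_apply_sub_one_lt h₀ hl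
  app_l_lt {t α} _ hα hl :=
    (congrArg (t.toTerm.eval θ) hl).trans_lt ((rdiv_id_apply_eq_top_iff hα).1 hl)
  last_l {t} _ h := by
    rw [value_last_eq_top_iff] at h ⊢
    exact proper_rdiv_id_iff.1 h
  app_l_last {t} _ h := by
    change t.toTerm.eval θ (value θ p (app (.l t) (last (.l t)))) = ⊤
    rw [value_app_last] at h ⊢
    exact top_unique (le_apply_rdiv_id_apply h)

theorem isDiagram_value : IsDiagram Δ (value θ p) :=
  ⟨structLaws_value Δ θ p, logicLaws_value Δ θ p, boundsLaws_value Δ θ p, rightLaws_value Δ θ p,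
    leftLaws_value Δ θ p⟩

end Value

end Sample

section Failure

variable (θ : ℕ → TimeWarp) {ts : List BasicTerm}

theorem eval_joinTerm_lt_iff (hts : ts ≠ []) {p c : ℕ∞} :
    (joinTerm ts).eval θ p < c ↔ ∀ t ∈ ts, t.toTerm.eval θ p < c := by
  induction ts with
  | nil => exact absurd rfl hts
  | cons t ts ih =>
    cases ts with
    | nil => rw [List.forall_mem_singleton]; rfl
    | cons u ts =>
      rw [List.forall_mem_cons, ← ih (List.cons_ne_nil u ts), ← sup_lt_iff, ← TimeWarp.join_apply]
      rfl

theorem not_holds_idLeJoin_iff (hts : ts ≠ []) :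
    ¬ (idLeJoin ts).Holds θ ↔ ∃ p : ℕ∞, ∀ t ∈ ts, t.toTerm.eval θ p < p := by
  have hholds : (idLeJoin ts).Holds θ ↔ ∀ p : ℕ∞, p ≤ (joinTerm ts).eval θ p :=
    DFunLike.ext_iff.trans (forall_congr' fun p => inf_eq_left)
  simp only [hholds, not_forall, not_le, eval_joinTerm_lt_iff θ hts]

theorem exists_realize_phi {κ : ℕ} (hts : ts ≠ []) (hθ : ¬ (idLeJoin ts).Holds θ) :
    ∃ w : Sample.diagramDomain κ ts → ℕ, (phi κ ts).Realize w := by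
  obtain ⟨p, hp⟩ := (not_holds_idLeJoin_iff θ hts).1 hθ
  have hiota (q : ℕ∞) : iota (Function.surjInv iota_surjective q) = q :=
    Function.surjInv_eq iota_surjective q
  exact ⟨fun a => Function.surjInv iota_surjective (Sample.value θ p a), realize_phi_iff.2
    ((Sample.realize_psiSet_iff _ fun a => hiota _).2
      ⟨Sample.isDiagram_value _ θ p, fun t ht _ => hp t ht⟩)⟩

end Failure

namespace Sample

open TimeWarp

/-- The time warp `f` takes at the points of a diagram `δ` the values that `δ` prescribes for the
basic term `t`, and attains its last value at `ω` only if `δ` says so. -/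
structure Extends (Δ : Set Sample) (δ : Sample → ℕ∞) (t : BasicTerm) (f : TimeWarp) : Prop where
  apply_eq : ∀ {α}, app t α ∈ Δ → f (δ α) = δ (app t α)
  proper : app t (last t) ∈ Δ → δ (last t) = ⊤ → Proper f

section Extends

variable {Δ : Set Sample} {δ : Sample → ℕ∞} {t u : BasicTerm} {f g : TimeWarp}

theorem IsDiagram.app_le_app_last (hΔ : Saturated Δ) (D : IsDiagram Δ δ) {α : Sample}
    (hα : app t α ∈ Δ) : δ (app t α) ≤ δ (app t (last t)) := by
  rcases le_total (δ (last t)) (δ α) with h | h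
  · exact ((D.last_le hα).1 h).le
  · exact D.mono hα (hΔ.appLast hα) h

theorem Extends.of_finite (hΔ : Saturated Δ) (D : IsDiagram Δ δ)
    (hfin : ∀ {α}, app t α ∈ Δ → δ α ≠ ⊤ → f (δ α) = δ (app t α))
    (hproper : app t (last t) ∈ Δ → δ (last t) = ⊤ → Proper f)
    (htop : ∀ {α}, app t α ∈ Δ → δ α = ⊤ → app t (last t) ∈ Δ → δ (last t) ≠ ⊤ →
      δ (app t (last t)) ≠ ⊤ → f ⊤ ≤ δ (app t (last t))) : Extends Δ δ t f := by
  refine ⟨fun {α} hα => ?_, hproper⟩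
  rcases ne_or_eq (δ α) ⊤ with h | h
  · exact hfin hα h
  have hlast := hΔ.appLast hα
  rw [(D.last_le hα).1 (h ▸ le_top), h]
  rcases eq_or_ne (δ (last t)) ⊤ with hlt | hlt
  · rw [D.app_last hlast hlt]
    exact (hproper hlast hlt).apply_top
  · refine le_antisymm ?_ (hfin hlast hlt ▸ monotone f le_top)
    rcases eq_or_ne (δ (app t (last t))) ⊤ with hv | hv
    · exact le_top.trans hv.ge
    · exact htop hα h hlast hlt hv

theorem Extends.ident (D : IsDiagram Δ δ) : Extends Δ δ .ident (sSupHom.id ℕ∞) :=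
  ⟨fun h => (D.ident h).symm, fun _ _ => proper_id⟩

theorem Extends.bot (hΔ : Saturated Δ) (D : IsDiagram Δ δ) : Extends Δ δ .bot ⊥ where
  apply_eq {α} h := by
    have hlast := D.last_bot h
    rw [(D.last_le h).1 (hlast.le.trans zero_le), D.app_zero (hΔ.appLast h) hlast]
    rfl
  proper h h' := absurd ((D.last_bot h).symm.trans h') ENat.zero_ne_top

theorem Extends.comp (hΔ : Saturated Δ) (D : IsDiagram Δ δ) (hf : Extends Δ δ t f)
    (hg : Extends Δ δ u g) : Extends Δ δ (.comp t u) (sSupHom.comp f g) where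
  apply_eq {α} h := by
    have htu := hΔ.comp h
    rw [D.comp h, ← hf.apply_eq htu, ← hg.apply_eq (hΔ.arg htu)]
    rfl
  proper h h' := by
    have htu := hΔ.comp h
    obtain ⟨ht, hu⟩ := D.last_comp h h'
    exact proper_comp_iff.2
      ⟨hf.proper (hΔ.appLast htu) ht, hg.proper (hΔ.appLast (hΔ.arg htu)) hu⟩

theorem Extends.o (hΔ : Saturated Δ) (D : IsDiagram Δ δ) (hf : Extends Δ δ t f) :
    Extends Δ δ (.o t) (ldiv top f) := by
  refine .of_finite hΔ D (fun {α} h hα => ?_) (fun h h' => absurd h' (D.last_o (hΔ.arg h)))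
    fun {α} hα hαt h _ hv => ?_
  · have hiff := D.o_eq_top_iff h hα
    rw [← hf.apply_eq (hΔ.o h)] at hiff
    rcases D.o_zero_or_top h with h₀ | ht
    · rw [h₀] at hiff ⊢
      exact ldiv_top_apply_eq_zero fun hc => ENat.zero_ne_top (hiff.2 hc)
    · rw [ht]
      exact ldiv_top_apply_eq_top hα (hiff.1 ht)
  · have hne : ∀ n : ℕ, f n ≠ ⊤ := fun n hn => by
      have hlast := hΔ.appLast (hΔ.o h)
      rcases eq_or_ne (δ (last t)) ⊤ with hlt | hlt
      · exact (hf.proper hlast hlt).apply_ne_top n (ENat.natCast_ne_top n) hn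
      · refine D.o_last hlast h hv hlt ?_
        rw [← (D.last_le (hΔ.o hα)).1 (hαt ▸ le_top), ← hf.apply_eq (hΔ.o hα), hαt]
        exact top_unique (hn.ge.trans (monotone f le_top))
    exact apply_top_le_iff.2 fun n => (ldiv_top_apply_eq_zero (hne n)).le.trans zero_le

theorem Extends.r (hΔ : Saturated Δ) (D : IsDiagram Δ δ) (hf : Extends Δ δ t f) :
    Extends Δ δ (.r t) (ldiv f (sSupHom.id ℕ∞)) := by
  have hsuc {α} (h : app (.r t) α ∈ Δ) : app t (.suc (app (.r t) α)) ∈ Δ ∧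
      δ (app t (.suc (app (.r t) α))) = f (δ (app (.r t) α) + 1) := by
    have hmem : app t (.suc (app (.r t) α)) ∈ Δ := hΔ h (.rSuc t α)
    exact ⟨hmem, by rw [← hf.apply_eq hmem, D.suc (hΔ.arg hmem)]⟩
  refine .of_finite hΔ D (fun {α} h hα => ?_)
    (fun h h' => proper_ldiv_id_iff.2 (hf.proper (hΔ.appLast (hΔ.r h)) (D.last_r h h')))
    fun _ _ h _ hv => ?_
  · rcases eq_or_ne (δ α) 0 with h₀ | h₀
    · rw [D.app_zero h h₀, h₀, apply_zero]
    have hle := D.app_r_le (hΔ.r h)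
    rw [← hf.apply_eq (hΔ.r h)] at hle
    have hlt := D.lt_app_suc_r (hsuc h).1 h₀ hα
    rw [(hsuc h).2] at hlt
    refine le_antisymm ?_ ((le_ldiv_apply_iff h₀ hα).2 hle)
    rcases eq_or_ne (δ (app (.r t) α)) ⊤ with ht | ht
    · exact le_top.trans ht.ge
    · exact (ENat.lt_add_one_iff ht).1 (ldiv_id_apply_lt (hlt ht))
  · have htop := D.app_suc_r_last (hsuc h).1 hv
    rw [(hsuc h).2] at htop
    exact apply_top_le_iff.2 fun n => (ENat.lt_add_one_iff hv).1
      (ldiv_id_apply_lt (htop ▸ ENat.natCast_lt_top n))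

theorem IsDiagram.le_pre_add_one (D : IsDiagram Δ δ) {α : Sample} (hα : .pre α ∈ Δ) :
    δ α ≤ δ (.pre α) + 1 := by
  rcases D.pre hα with h | ⟨-, h⟩
  · exact h.le
  · exact h.le.trans zero_le

theorem Extends.l (hΔ : Saturated Δ) (D : IsDiagram Δ δ) (hf : Extends Δ δ t f) :
    Extends Δ δ (.l t) (rdiv (sSupHom.id ℕ∞) f) := by
  refine .of_finite hΔ D (fun {α} h hα => ?_)
    (fun h h' => proper_rdiv_id_iff.2 (hf.proper (hΔ.appLast (hΔ.l h)) (D.last_l h h')))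
    fun _ _ h _ hv => ?_
  · rcases eq_or_ne (δ α) 0 with h₀ | h₀
    · rw [D.app_zero h h₀, h₀, apply_zero]
    rcases eq_or_ne (δ (app (.l t) α)) ⊤ with ht | ht
    · have hlt := D.app_l_lt (hΔ.l h) hα ht
      rw [← hf.apply_eq (hΔ.l h), ht] at hlt
      rw [ht, rdiv_id_apply_eq_top_iff hα]
      exact hlt
    · have hle := D.le_app_l (hΔ.l h) ht
      rw [← hf.apply_eq (hΔ.l h)] at hle
      have hmem : app t (.pre (app (.l t) α)) ∈ Δ := hΔ h (.lPre t α)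
      have hlt := D.app_pre_l_lt hmem h₀ hα ht
      rw [← hf.apply_eq hmem] at hlt
      refine (rdiv_id_apply_le hle).antisymm ((le_rdiv_apply_iff h₀ hα).2 fun q hq => ?_)
      have hpre : δ (.pre (app (.l t) α)) < q :=
        lt_of_not_ge fun hge => hlt.not_ge (hq.trans (monotone f hge))
      exact (D.le_pre_add_one (hΔ.arg hmem)).trans (Order.add_one_le_of_lt hpre)
  · have htop := D.app_l_last h hv
    rw [← hf.apply_eq (hΔ.l h)] at htop
    exact rdiv_id_apply_le htop.ge

theorem extends_eval (hΔ : Saturated Δ) (D : IsDiagram Δ δ) {θ : ℕ → TimeWarp}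
    (hθ : ∀ x, Extends Δ δ (.var x) (θ x)) (t : BasicTerm) :
    Extends Δ δ t (t.toTerm.eval θ) := by
  induction t with
  | var x => exact hθ x
  | comp t u iht ihu => exact .comp hΔ D iht ihu
  | o t ih => exact .o hΔ D ih
  | l t ih => exact .l hΔ D ih
  | r t ih => exact .r hΔ D ih
  | ident => exact .ident D
  | bot => exact .bot hΔ D

end Extends

section Extension

variable (Δ : Set Sample) (δ : Sample → ℕ∞) (N x : ℕ)

/-- The least time warp that takes at the finite points of `δ` at least the values prescribed for
the variable `x`, joined with a shift of the identity by `N` if the last value is to be attained at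
`ω` only. -/
noncomputable def extension : TimeWarp :=
  sup ({f | ∃ α, app (.var x) α ∈ Δ ∧ δ α ≠ ⊤ ∧ f = step (δ α - 1) (δ (app (.var x) α))} ∪
    {f | last (.var x) ∈ Δ ∧ δ (last (.var x)) = ⊤ ∧ f = shift N})

variable {Δ δ N x}

theorem extension_apply_le_iff (D : IsDiagram Δ δ) {p q : ℕ∞} :
    extension Δ δ N x p ≤ q ↔
      (∀ α, app (.var x) α ∈ Δ → δ α ≠ ⊤ → δ α ≤ p → δ (app (.var x) α) ≤ q) ∧
        (last (.var x) ∈ Δ → δ (last (.var x)) = ⊤ → p - N ≤ q) := by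
  have hstep (α) (h : app (.var x) α ∈ Δ) (hα : δ α ≠ ⊤) :
      step (δ α - 1) (δ (app (.var x) α)) p ≤ q ↔ δ α ≤ p → δ (app (.var x) α) ≤ q := by
    rw [step_apply, iSup_le_iff]
    rcases eq_or_ne (δ α) 0 with h₀ | h₀
    · simp only [D.app_zero h h₀, zero_le, implies_true]
    · rw [sub_one_lt_iff h₀ hα]
  rw [extension, sup_apply_le_iff]
  simp only [Set.mem_union, or_imp, forall_and]
  refine and_congr ⟨fun H α h hα => (hstep α h hα).1 (H _ ⟨α, h, hα, rfl⟩), ?_⟩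
    ⟨fun H h hl => H _ ⟨h, hl, rfl⟩, ?_⟩
  · rintro H _ ⟨α, h, hα, rfl⟩
    exact (hstep α h hα).2 (H α h hα)
  · rintro H _ ⟨h, hl, rfl⟩
    exact H h hl

theorem extension_apply_of_ne_top (hΔ : Saturated Δ) (D : IsDiagram Δ δ)
    (hN : ∀ α ∈ Δ, δ α ≠ ⊤ → δ α ≤ N) {α : Sample} (h : app (.var x) α ∈ Δ) (hα : δ α ≠ ⊤) :
    extension Δ δ N x (δ α) = δ (app (.var x) α) := by
  refine le_antisymm ((extension_apply_le_iff D).2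
    ⟨fun β hβ _ hle => D.mono hβ h hle, fun _ _ => ?_⟩)
    (((extension_apply_le_iff D).1 le_rfl).1 α h hα le_rfl)
  rw [tsub_eq_zero_of_le (hN α (hΔ.arg h) hα)]
  exact zero_le

theorem proper_extension (hΔ : Saturated Δ) (D : IsDiagram Δ δ)
    (hN : ∀ α ∈ Δ, δ α ≠ ⊤ → δ α ≤ N) (h : app (.var x) (last (.var x)) ∈ Δ)
    (hlast : δ (last (.var x)) = ⊤) : Proper (extension Δ δ N x) := by
  refine ⟨top_unique ?_, fun p hp => ne_top_of_le_ne_top (b := max (N : ℕ∞) p)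
    (max_ne_top (ENat.natCast_ne_top N) hp) ((extension_apply_le_iff D).2 ⟨fun β hβ hβt _ => ?_,
      fun _ _ => tsub_le_self.trans (le_max_right _ _)⟩)⟩
  · rw [← ENat.top_sub_natCast N]
    exact ((extension_apply_le_iff D).1 le_rfl).2 (hΔ.arg h) hlast
  · refine (hN _ hβ fun hc => hβt (top_unique ?_)).trans (le_max_left _ _)
    rw [← hlast, D.last_le hβ, hc, D.app_last h hlast]

theorem extends_extension (hΔ : Saturated Δ) (D : IsDiagram Δ δ)
    (hN : ∀ α ∈ Δ, δ α ≠ ⊤ → δ α ≤ N) : Extends Δ δ (.var x) (extension Δ δ N x) :=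
  .of_finite hΔ D (extension_apply_of_ne_top hΔ D hN) (proper_extension hΔ D hN)
    fun _ _ _ hlast _ => (extension_apply_le_iff D).2
      ⟨fun _ hβ _ _ => D.app_le_app_last hΔ hβ, fun _ ht => absurd ht hlast⟩

end Extension

end Sample

section Codes

theorem BasicTerm.code_injective : Function.Injective BasicTerm.code := by
  intro t u h
  induction t generalizing u <;> cases u <;> grind [BasicTerm.code, Nat.pair_eq_pair]

theorem Sample.code_injective : Function.Injective Sample.code := by
  intro α β h
  induction α generalizing β <;> cases β <;>
    grind [Sample.code, Nat.pair_eq_pair, BasicTerm.code_injective.eq_iff]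

theorem mem_codeGraph_iff {Δ : Set Sample} {w : Δ → ℕ} {G : List (Sample × ℕ)}
    (hG : Enumerates G w) {e : ℕ × ℕ} : e ∈ codeGraph G ↔ ∃ a : Δ, (a.1.code, w a) = e := by
  refine List.mem_map.trans ⟨?_, fun ⟨a, ha⟩ => ⟨(a, w a), (hG a _).2 ⟨a.2, rfl⟩, ha⟩⟩
  rintro ⟨⟨α, k⟩, hmem, rfl⟩
  obtain ⟨hα, rfl⟩ := (hG α k).1 hmem
  exact ⟨⟨α, hα⟩, rfl⟩

end Codes

section Representatives

/-- The representative under `ι` of the maximum of two represented elements of `ω ∪ {ω}`. -/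
def iotaMax (a b : ℕ) : ℕ := if a = 0 then 0 else if b = 0 then 0 else max a b

theorem iota_iotaMax (a b : ℕ) : iota (iotaMax a b) = iota a ⊔ iota b := by
  rcases a with _ | a <;> rcases b with _ | b <;> simp [iotaMax, iota, Nat.mono_cast.map_max]

/-- The representative under `ι` of the supremum of finitely many represented elements of
`ω ∪ {ω}`; the empty supremum `0` is represented by `1`. -/
def iotaSup (l : List ℕ) : ℕ := l.foldr iotaMax 1

theorem iota_iotaSup_le_iff {l : List ℕ} {q : ℕ∞} : iota (iotaSup l) ≤ q ↔ ∀ k ∈ l, iota k ≤ q := by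
  induction l with
  | nil => exact iff_of_true zero_le (List.forall_mem_nil _)
  | cons k l ih => rw [List.forall_mem_cons, ← ih, ← sup_le_iff, ← iota_iotaMax]; rfl

/-- The representative under `ι` of the difference of a represented element of `ω ∪ {ω}` and the
natural number `N`. -/
def iotaSub (m N : ℕ) : ℕ := if m = 0 then 0 else m - 1 - N + 1

theorem iota_iotaSub (m N : ℕ) : iota (iotaSub m N) = iota m - N := by
  rcases m with _ | m <;> simp [iotaSub, iota]

/-- The largest second component of a pair in `G`, and `0` if there is none. -/
def maxValue (G : List (ℕ × ℕ)) : ℕ := (G.map Prod.snd).foldr max 0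

theorem maxValue_le_iff {G : List (ℕ × ℕ)} {c : ℕ} : maxValue G ≤ c ↔ ∀ e ∈ G, e.2 ≤ c := by
  induction G with
  | nil => exact iff_of_true (Nat.zero_le c) (List.forall_mem_nil _)
  | cons e G ih => rw [List.forall_mem_cons, ← ih]; exact max_le_iff

theorem isLUB_maxValue_codeGraph {Δ : Set Sample} {w : Δ → ℕ} {G : List (Sample × ℕ)}
    (hG : Enumerates G w) : IsLUB (Set.range w) (maxValue (codeGraph G)) := by
  refine isLUB_iff_le_iff.2 fun c => ?_
  simp only [maxValue_le_iff, mem_codeGraph_iff hG, mem_upperBounds, Set.forall_mem_range,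
    forall_exists_index, forall_apply_eq_imp_iff]

end Representatives

section ExtensionValue

/-- The value at `ι m` of the time warp `Sample.extension` of the variable `x`, computed on
representatives from the coded graph `G` of an assignment. -/
def extensionValue (G : List (ℕ × ℕ)) (x m : ℕ) : ℕ :=
  -- `Nat.pair 1 (Nat.pair (Nat.pair 0 x) b)` is the code of `x[α]` when `b` is that of `α`, and
  -- `Nat.pair 4 (Nat.pair 0 x)` is the code of `last(x)`.
  iotaSup ((G.flatMap fun d => (G.filter fun e =>
      e.1 = Nat.pair 1 (Nat.pair (Nat.pair 0 x) d.1) ∧ d.2 ≠ 0 ∧ (m = 0 ∨ d.2 ≤ m)).map Prod.snd) ++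
    (G.filter fun e => e = (Nat.pair 4 (Nat.pair 0 x), 0)).map fun _ => iotaSub m (maxValue G))

theorem iota_extensionValue_le_iff {G : List (ℕ × ℕ)} {x m : ℕ} {q : ℕ∞} :
    iota (extensionValue G x m) ≤ q ↔
      (∀ d ∈ G, ∀ e ∈ G, e.1 = Nat.pair 1 (Nat.pair (Nat.pair 0 x) d.1) → iota d.2 ≠ ⊤ →
        iota d.2 ≤ iota m → iota e.2 ≤ q) ∧
      ((Nat.pair 4 (Nat.pair 0 x), 0) ∈ G → iota m - maxValue G ≤ q) := by
  rw [extensionValue, iota_iotaSup_le_iff, List.forall_mem_append, ← iota_iotaSub]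
  simp only [List.mem_flatMap, List.mem_map, List.mem_filter, decide_eq_true_eq, ne_eq,
    iota_eq_top_iff, iota_le_iff]
  refine and_congr ⟨fun H d hd e he hcode h₀ hle => ?_, ?_⟩ ⟨fun H h => ?_, ?_⟩
  · exact H _ ⟨d, hd, e, ⟨he, hcode, h₀, hle.imp_right And.right⟩, rfl⟩
  · rintro H _ ⟨d, hd, e, ⟨he, hcode, h₀, hle⟩, rfl⟩
    exact H d hd e he hcode h₀ (hle.imp_right (And.intro h₀))
  · exact H _ ⟨_, ⟨h, rfl⟩, rfl⟩
  · rintro H _ ⟨_, ⟨h, rfl⟩, rfl⟩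
    exact H h

open Sample in
theorem iota_extensionValue_codeGraph {Δ : Set Sample} {δ : Sample → ℕ∞} {w : Δ → ℕ}
    (hδ : ∀ a : Δ, iota (w a) = δ a) (hΔ : Saturated Δ) (D : IsDiagram Δ δ)
    {G : List (Sample × ℕ)} (hG : Enumerates G w) (x m : ℕ) :
    iota (extensionValue (codeGraph G) x m) =
      extension Δ δ (maxValue (codeGraph G)) x (iota m) := by
  refine eq_of_forall_ge_iff fun q => ?_
  rw [iota_extensionValue_le_iff, extension_apply_le_iff D]
  simp only [mem_codeGraph_iff hG, forall_exists_index, forall_apply_eq_imp_iff, hδ]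
  refine and_congr ⟨fun H α hα => ?_, fun H a b hab => ?_⟩ ⟨fun H h hlast => ?_, fun H a ha => ?_⟩
  · exact H ⟨α, hΔ.arg hα⟩ ⟨_, hα⟩ rfl
  · have hb : b.1 = app (.var x) a := code_injective hab
    rw [hb]
    exact H a (hb ▸ b.2)
  · exact H ⟨_, h⟩ (Prod.ext rfl (iota_eq_top_iff.1 ((hδ _).trans hlast)))
  · obtain ⟨hcode, hw⟩ := Prod.ext_iff.1 ha
    have ha' : a.1 = last (.var x) := code_injective hcode
    exact H (ha' ▸ a.2) (ha' ▸ (hδ a).symm.trans (iota_eq_top_iff.2 hw))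

end ExtensionValue

section Computability

open Primrec

theorem primrec₂_iotaMax : Primrec₂ iotaMax :=
  Primrec.ite (Primrec.eq.comp fst (const 0)) (const 0)
    (Primrec.ite (Primrec.eq.comp snd (const 0)) (const 0) nat_max)

theorem primrec_iotaSup : Primrec iotaSup :=
  list_foldr .id (const 1) (primrec₂_iotaMax.comp (fst.comp snd) (snd.comp snd)).to₂

theorem primrec₂_iotaSub : Primrec₂ iotaSub :=
  Primrec.ite (Primrec.eq.comp fst (const 0)) (const 0)
    (succ.comp (nat_sub.comp (nat_sub.comp fst (const 1)) snd))

theorem primrec_maxValue : Primrec maxValue :=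
  list_foldr (list_map .id (snd.comp snd).to₂) (const 0)
    (nat_max.comp (fst.comp snd) (snd.comp snd)).to₂

theorem primrec₂_extensionValue :
    Primrec₂ fun (a : List (ℕ × ℕ) × ℕ) (m : ℕ) => extensionValue a.1 a.2 m := by
  have hG : Primrec fun a : (List (ℕ × ℕ) × ℕ) × ℕ => a.1.1 := fst.comp fst
  have hx : Primrec fun a : (List (ℕ × ℕ) × ℕ) × ℕ => Nat.pair 0 a.1.2 :=
    Primrec₂.natPair.comp (const 0) (snd.comp fst)
  have hstep : PrimrecRel fun (e : ℕ × ℕ) (a : ((List (ℕ × ℕ) × ℕ) × ℕ) × (ℕ × ℕ)) =>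
      e.1 = Nat.pair 1 (Nat.pair (Nat.pair 0 a.1.1.2) a.2.1) ∧ a.2.2 ≠ 0 ∧
        (a.1.2 = 0 ∨ a.2.2 ≤ a.1.2) := by
    have hj : Primrec fun b : (ℕ × ℕ) × (((List (ℕ × ℕ) × ℕ) × ℕ) × (ℕ × ℕ)) => b.2.2.2 :=
      snd.comp (snd.comp snd)
    have hm : Primrec fun b : (ℕ × ℕ) × (((List (ℕ × ℕ) × ℕ) × ℕ) × (ℕ × ℕ)) => b.2.1.2 :=
      snd.comp (fst.comp snd)
    refine .and ?_ ((Primrec.eq.comp hj (const 0)).not.and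
      ((Primrec.eq.comp hm (const 0)).or (nat_le.comp hj hm)))
    exact Primrec.eq.comp (fst.comp fst) (Primrec₂.natPair.comp (const 1)
      (Primrec₂.natPair.comp (hx.comp (fst.comp snd)) (fst.comp (snd.comp snd))))
  have hlast : PrimrecRel fun (e : ℕ × ℕ) (a : (List (ℕ × ℕ) × ℕ) × ℕ) =>
      e = (Nat.pair 4 (Nat.pair 0 a.1.2), 0) :=
    Primrec.eq.comp fst ((Primrec₂.natPair.comp (const 4) (hx.comp snd)).pair (const 0))
  refine primrec_iotaSup.comp (list_append.comp (list_flatMap hG ?_) (list_map ?_ ?_))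
  · exact (list_map (hstep.listFilter.comp (hG.comp fst) .id) (snd.comp snd).to₂).to₂
  · exact hlast.listFilter.comp hG .id
  · exact (primrec₂_iotaSub.comp (snd.comp fst) (primrec_maxValue.comp (hG.comp fst))).to₂

theorem exists_computable_mem_eval {A : Type*} [Primcodable A] {f : A → ℕ → ℕ}
    (hf : Computable₂ f) :
    ∃ D : A → Nat.Partrec.Code, Computable D ∧ ∀ a m, f a m ∈ (D a).eval m := by
  obtain ⟨c, hc⟩ := Nat.Partrec.Code.exists_code.1 hf
  refine ⟨fun a => c.curry (Encodable.encode a),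
    (Nat.Partrec.Code.primrec₂_curry.comp (const c) .encode).to_comp, fun a m => ?_⟩
  have hpair : Nat.pair (Encodable.encode a) m = Encodable.encode (a, m) := rfl
  rw [Nat.Partrec.Code.eval_curry, hc, hpair]
  simp

end Computability

theorem exists_valuation_of_realize_phi {κ : ℕ} {ts : List BasicTerm} (hts : ts ≠ [])
    {w : Sample.diagramDomain κ ts → ℕ} (hw : (phi κ ts).Realize w) :
    ∃ θ : ℕ → TimeWarp, ¬ (idLeJoin ts).Holds θ ∧ ∀ G : List (Sample × ℕ), Enumerates G w →
      ∀ x m : ℕ, iota (extensionValue (codeGraph G) x m) = θ x (iota m) := by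
  let δ : Sample → ℕ∞ := Function.extend Subtype.val (iota ∘ w) 0
  have hδ (a) : iota (w a) = δ a := (Subtype.val_injective.extend_apply (iota ∘ w) 0 a).symm
  have hΔ : Sample.Saturated (Sample.diagramDomain κ ts) := Sample.saturated_saturation _
  obtain ⟨D, hfail⟩ := (Sample.realize_psiSet_iff hΔ hδ).1 (realize_phi_iff.1 hw)
  have hlub : IsLUB (Set.range w) (⨆ a, w a) := isLUB_csSup' (Set.finite_range w).bddAbove
  have hN : ∀ α ∈ Sample.diagramDomain κ ts, δ α ≠ ⊤ → δ α ≤ (⨆ a, w a : ℕ) := fun α hα ht => by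
    rw [← hδ ⟨α, hα⟩, ne_eq, iota_eq_top_iff] at ht
    refine le_trans ?_ (Nat.cast_le.2 (hlub.1 ⟨⟨α, hα⟩, rfl⟩))
    rw [← hδ ⟨α, hα⟩]
    obtain ⟨k, hk⟩ := Nat.exists_eq_succ_of_ne_zero ht
    rw [hk]
    exact Nat.cast_le.2 k.le_succ
  have hext := Sample.extends_eval hΔ D fun x => Sample.extends_extension (x := x) hΔ D hN
  refine ⟨Sample.extension (Sample.diagramDomain κ ts) δ (⨆ a, w a),
    (not_holds_idLeJoin_iff _ hts).2 ⟨δ (.tvar κ), fun t ht => ?_⟩, fun G hG x m => ?_⟩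
  · have hmem : Sample.app t (.tvar κ) ∈ Sample.diagramDomain κ ts :=
      Sample.subset_saturation _ ⟨t, ht, rfl⟩
    exact ((hext t).apply_eq hmem).trans_lt (hfail t ht hmem)
  · rw [iota_extensionValue_codeGraph hδ hΔ D hG, (isLUB_maxValue_codeGraph hG).unique hlub]

theorem theorem4 :
    (∀ (κ : ℕ) (ts : List BasicTerm), ts ≠ [] →
      (phi κ ts).IsQF ∧
      ((idLeJoin ts).Valid ↔ ¬ ∃ w : Sample.diagramDomain κ ts → ℕ, (phi κ ts).Realize w)) ∧
    ∃ D : List (ℕ × ℕ) × ℕ → Nat.Partrec.Code, Computable D ∧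
      ∀ (κ : ℕ) (ts : List BasicTerm), ts ≠ [] →
        ∀ w : Sample.diagramDomain κ ts → ℕ, (phi κ ts).Realize w →
          ∃ θ : ℕ → TimeWarp, ¬ (idLeJoin ts).Holds θ ∧
            ∀ G : List (Sample × ℕ), Enumerates G w →
              ∀ x : ℕ, Describes (D (codeGraph G, x)) (θ x) := by
  refine ⟨fun κ ts hts => ⟨isQF_phi κ ts, ?_, fun hunsat θ => ?_⟩, ?_⟩
  · rintro hvalid ⟨w, hw⟩
    obtain ⟨θ, hθ, -⟩ := exists_valuation_of_realize_phi hts hw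
    exact hθ (hvalid θ)
  · exact by_contra fun hθ => hunsat (exists_realize_phi θ hts hθ)
  · obtain ⟨D, hD, heval⟩ := exists_computable_mem_eval primrec₂_extensionValue.to_comp
    refine ⟨D, hD, fun κ ts hts w hw => ?_⟩
    obtain ⟨θ, hθ, hvalue⟩ := exists_valuation_of_realize_phi hts hw
    exact ⟨θ, hθ, fun G hG x m => ⟨_, heval (codeGraph G, x) m, hvalue G hG x m⟩⟩
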